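/- Let $p$ be a prime, let $\mathbb{C}_p$ be the field of $p$-adic complex numbers with absolute value $|\cdot|_p$ normalized by $|p|_p=1/p$ and valuation $v_p=-\log_p|\cdot|_p$ (with $v_p(0)=\infty$), and for real $r\ge 0$ let $D(\infty,r)=\{z\in\mathbb{C}_p:|z|_p>r\}$. Let $d\ge 2$ and $N\ge 0$ be integers, let $c\in\mathbb{C}_p$, and put $f_c(z)=z^d-c$. Assume that one of the following two conditions holds. Condition A: $N=0$, $d$ is a multiple of $p$, and $v_p(c)<v_p(d)+\frac{v_p((d-1)!)}{d-1}$. Condition B: $N\ge 1$, $d$ is a power of $p$, and $Nv_p(d)+\frac{v_p((d-1)!)}{d-1}<v_p(c)<(N+1)v_p(d)+\frac{v_p((d-1)!)}{d-1}$. Then there is a unique formal series $\varphi_c(z)=z\bigl(1+\sum_{n\ge 1}a_nz^{-nd}\bigr)$ with coefficients $a_n\in\mathbb{C}_p$ such that $f_c(\varphi_c(z))=\varphi_c(z^d)$ (the inverse of the Böttcher coordinate of $f_c$ at $\infty$), and it has a unique formal compositional inverse $\varphi_c^{-1}(z)=z\bigl(1+\sum_{m\ge 1}e_mz^{-m}\bigr)$,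 $e_m\in\mathbb{C}_p$. Put $$r_N=\left(\left|\frac{c}{d^{N+1}}\right|_p p^{1/(p-1)}\right)^{1/d^N}.$$ Then $r_N>1$, and the maximal convergent open disks of $\varphi_c(z)$ and of $\varphi_c^{-1}(z)$ (for each of these series, the largest disk $D(\infty,r)$, $r\ge 0$, at every point of which the series converges) are both equal to $D(\infty,r_N^{1/d})$. Moreover, $\varphi_c$ gives a bijection from $D(\infty,r_N^{1/d})$ onto itself with $|\varphi_c(z)-\varphi_c(w)|_p=|z-w|_p$ for all $z,w\in D(\infty,r_N^{1/d})$. -/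

import Mathlib

noncomputable section

namespace BottcherAtInfinity

/-! ### Formal series `F(z) = z * (e₀ + e₁ z⁻¹ + e₂ z⁻² + ⋯)` at infinity

Such a series is encoded by the power series `E = e₀ + e₁ X + e₂ X² + ⋯`, so that
`F(z) = z * E(1/z)`. Formal Laurent series in `1/z` are the elements of `LaurentSeries K`, whose
uniformizer is read as `1/z`. -/

section Formal

variable {K : Type*} [Field K]

/-- The formal variable `z`, as a Laurent series in `1/z`. -/
def z (K : Type*) [Field K] : LaurentSeries K := HahnSeries.single (-1 : ℤ) (1 : K)

/-- The formal substitution `F(u) = u * E(1/u) = ∑ n, eₙ u ^ (1 - n)`, for a Laurent series `u` in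
`1/z` which has a pole at infinity (so that `1/u` has positive order and the sum makes sense). -/
def formalEval (E : PowerSeries K) (u : LaurentSeries K) : LaurentSeries K :=
  u * PowerSeries.heval u⁻¹ E

/-- `E` encodes a series `φ(z) = z * (1 + ∑_{n ≥ 1} aₙ / z ^ (n d))` such that
`φ(z) ^ d - c = φ(z ^ d)`, i.e. `f_c (φ(z)) = φ(z ^ d)` with `f_c(z) = z ^ d - c`. -/
structure IsInverseBottcher (d : ℕ) (c : K) (E : PowerSeries K) : Prop where
  coeff_zero : PowerSeries.coeff 0 E = 1
  coeff_eq_zero : ∀ m : ℕ, ¬ d ∣ m → PowerSeries.coeff m E = 0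
  functional_eq : formalEval E (z K) ^ d - HahnSeries.C c = formalEval E (z K ^ d)

/-- `G` encodes the compositional inverse `z * (1 + O(1/z))` of the formal series encoded by `E`:
`F_E (F_G (z)) = z` and `F_G (F_E (z)) = z`. -/
structure IsFormalInverse (E G : PowerSeries K) : Prop where
  coeff_zero : PowerSeries.coeff 0 G = 1
  right_inv : formalEval E (formalEval G (z K)) = z K
  left_inv : formalEval G (formalEval E (z K)) = z K

end Formal

/-! ### Convergence in `ℂ_[p]` -/

section Analytic

variable (p : ℕ) [Fact p.Prime]

/-- The `p`-adic valuation on `ℂ_[p]`, with `v_p(p) = 1` and `v_p(0) = ∞`. -/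
def vp (x : ℂ_[p]) : EReal :=
  open Classical in if x = 0 then ⊤ else ((-Real.logb p ‖x‖ : ℝ) : EReal)

/-- The open disk `D(∞, r) = {x ∈ ℂ_p : |x| > r}`. -/
def diskAtInfinity (r : ℝ) : Set ℂ_[p] := {x | r < ‖x‖}

variable {p}

/-- The series `∑ n, eₙ x ^ (1 - n)` converges at the point `x`. -/
def ConvergesAt (E : PowerSeries ℂ_[p]) (x : ℂ_[p]) : Prop :=
  Summable fun n : ℕ => PowerSeries.coeff n E * x ^ (1 - (n : ℤ))

/-- The value `∑ n, eₙ x ^ (1 - n)` of the series at the point `x`. -/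
def value (E : PowerSeries ℂ_[p]) (x : ℂ_[p]) : ℂ_[p] :=
  ∑' n : ℕ, PowerSeries.coeff n E * x ^ (1 - (n : ℤ))

/-- `D` is the maximal convergent open disk of the series encoded by `E`: the largest among the
open disks `D(∞, r)`, `r ≥ 0`, at all of whose points the series converges. -/
def IsMaximalConvergentDisk (E : PowerSeries ℂ_[p]) (D : Set ℂ_[p]) : Prop :=
  IsGreatest
    {U : Set ℂ_[p] | ∃ r : ℝ, 0 ≤ r ∧ U = diskAtInfinity p r ∧ ∀ x ∈ U, ConvergesAt E x} D

variable (p)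

/-- Condition A: `N = 0`, `d` is a multiple of `p` and
`v_p(c) < v_p(d) + v_p((d-1)!) / (d-1)`. -/
def ConditionA (N d : ℕ) (c : ℂ_[p]) : Prop :=
  N = 0 ∧ p ∣ d ∧
    vp p c < (((padicValNat p d : ℝ)
      + (padicValNat p (Nat.factorial (d - 1)) : ℝ) / ((d : ℝ) - 1) : ℝ) : EReal)

/-- Condition B: `N ≥ 1`, `d` is a power of `p` and
`N v_p(d) + v_p((d-1)!) / (d-1) < v_p(c) < (N+1) v_p(d) + v_p((d-1)!) / (d-1)`. -/
def ConditionB (N d : ℕ) (c : ℂ_[p]) : Prop :=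
  1 ≤ N ∧ (∃ k : ℕ, d = p ^ k) ∧
    (((N : ℝ) * (padicValNat p d : ℝ)
      + (padicValNat p (Nat.factorial (d - 1)) : ℝ) / ((d : ℝ) - 1) : ℝ) : EReal) < vp p c ∧
    vp p c < ((((N : ℝ) + 1) * (padicValNat p d : ℝ)
      + (padicValNat p (Nat.factorial (d - 1)) : ℝ) / ((d : ℝ) - 1) : ℝ) : EReal)

/-- `r_N = (|c / d ^ (N+1)|_p * p ^ (1/(p-1))) ^ (1 / d ^ N)`. -/
def rN (N d : ℕ) (c : ℂ_[p]) : ℝ :=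
  (‖c / (d : ℂ_[p]) ^ (N + 1)‖ * (p : ℝ) ^ (1 / ((p : ℝ) - 1))) ^ (1 / (d : ℝ) ^ N)

end Analytic

end BottcherAtInfinity

end

open BottcherAtInfinity

/-!
Write `φ(z) = z * A(1 / z ^ d)` with `A = 1 + v`. The functional equation of `φ` becomes
`A ^ d = A(X ^ d) + c X`, which determines the coefficients of `A` one after the other, so that `φ`
exists and is unique. Everything else follows from the sizes of these coefficients. Put
`q = p ^ (-1 / (p - 1))` (`expRadius p`) and `R = 1 / r_N`.

The linear term of `(1 + v) ^ d - 1` dominates the others on the series `v` whose Gauss norm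
`sup ‖vₙ‖ ρ ^ n` is at most `q`, because `‖d.choose k‖ * q ^ (k - 1) ≤ ‖d‖`
(`GaussLe.one_add_pow_sub`). Hence extracting a `d`-th root of `1 + u` divides the Gauss norm of `u`
by `‖d‖`, as long as `u` has norm at most `q * ‖d‖`. In the functional equation `u` is
`v(X ^ d) + c X`, and the Gauss norm of `v(X ^ d)` at the radius `R ^ (d ^ j)` is the one of `v` at
`R ^ (d ^ (j + 1))`. So the norms at all these radii are controlled together, by the comparison of
`‖c‖ R ^ (d ^ j)` with `q * ‖d‖ ^ (j + 1)`. The radius `r_N` is the one at which the two agree for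
`j = N`, and conditions A and B say precisely enough to make `j = N` a strict maximum of their ratio
(`critical_radius`, `exists_peak`): the ratio grows before `N` and decreases after `N`. It follows
that `v` has Gauss norm at most `q` at `R`, and that up to terms of norm less than `q`, the series
`A` is the `d`-th root of `1 + (c / d ^ N) X ^ (d ^ N)`. This binomial series lies exactly on its
circle of convergence, and its coefficients in the degrees `d ^ N * p ^ k` have size exactly `q`
there; so do those of `A` (`norm_coeff_of_functional_eq`). This yields the radius of convergence of
`A`.

For `E = A(X ^ d)`, the power series in `1 / z` of `φ(z) / z`, the condition on the inverse
`z * G(1 / z)` is the equation `E * G(X / E) = 1`, which is triangular in the coefficients of `G`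
and shows that `G - 1` is `-(E - 1)` up to terms of norm at most `q ^ 2 < q` (`GaussLe.inverse`).
Thus `G` has the same radius of convergence. Finally, the bound by `q < 1` makes `φ(z) - z` a
contraction of ratio `q` of the disk, whence the isometry, and the surjectivity by the Banach
fixed-point theorem on spheres (`bijOn_value`).
-/

namespace BottcherAtInfinity

open PowerSeries

/-! ### Triangular fixed-point problems for power series -/

section Formal

variable {K : Type*} [Field K]

/-- The coefficients of the solution of `T f = f`, when the `n`-th coefficient of `T f` only
depends on the coefficients of `f` of index less than `n`. -/
noncomputable def fixedCoeff (T : K⟦X⟧ → K⟦X⟧) (n : ℕ) : K :=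
  coeff n (T (mk fun i => if _h : i < n then fixedCoeff T i else 0))

/-- An operator whose output in degree `n` only depends on the input in degrees less than `n` has a
unique fixed point. -/
theorem existsUnique_fixed (T : K⟦X⟧ → K⟦X⟧)
    (hT : ∀ n f g, X ^ n ∣ f - g → coeff n (T f) = coeff n (T g)) : ∃! f, T f = f := by
  refine ⟨mk (fixedCoeff T), ?_, fun f hf => ?_⟩
  · ext n
    rw [coeff_mk, fixedCoeff]
    refine hT _ _ _ (X_pow_dvd_iff.2 fun m hm => ?_)
    simp [hm]
  · ext n
    induction n using Nat.strong_induction_on with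
    | _ n ih =>
      rw [coeff_mk, fixedCoeff, ← hf]
      refine hT _ _ _ (X_pow_dvd_iff.2 fun m hm => ?_)
      rw [map_sub, coeff_mk, dif_pos hm, sub_eq_zero, ih m hm, coeff_mk]

/-- In the lowest degree where `v` and `w` may differ, `(1 + v) ^ d - (1 + w) ^ d` only sees the
linear term `d * (v - w)`. -/
theorem coeff_one_add_pow_sub (d n : ℕ) {v w : K⟦X⟧} (hv : constantCoeff v = 0)
    (hw : constantCoeff w = 0) (h : X ^ n ∣ v - w) :
    coeff n ((1 + v) ^ d - (1 + w) ^ d) = d * coeff n (v - w) := by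
  obtain ⟨r, hr⟩ := h
  have e : (1 + v) ^ d - (1 + w) ^ d
      = X ^ n * (r * ∑ i ∈ Finset.range d, (1 + v) ^ i * (1 + w) ^ (d - 1 - i)) := by
    rw [← geom_sum₂_mul, add_sub_add_left_eq_sub, hr]; ring
  have h0 (f : K⟦X⟧) : coeff n (X ^ n * f) = constantCoeff f := by
    have := coeff_X_pow_mul f n 0
    simpa using this
  rw [e, hr, h0, h0]
  simp [hv, hw, mul_comm]

theorem X_pow_dvd_sub_trunc (n : ℕ) (v : K⟦X⟧) : X ^ n ∣ v - (trunc n v : K⟦X⟧) :=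
  X_pow_dvd_iff.2 fun m hm => by simp [coeff_trunc, hm]

theorem constantCoeff_trunc_eq_zero (n : ℕ) {v : K⟦X⟧} (hv : constantCoeff v = 0) :
    constantCoeff (trunc n v : K⟦X⟧) = 0 := by
  rw [← coeff_zero_eq_constantCoeff_apply, Polynomial.coeff_coe, coeff_trunc]
  split_ifs
  · simpa using hv
  · rfl

theorem coeff_one_add_pow_eq (d n : ℕ) {v : K⟦X⟧} (hv : constantCoeff v = 0) :
    coeff n ((1 + v) ^ d) = d * coeff n v + coeff n ((1 + (trunc n v : K⟦X⟧)) ^ d) := by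
  have := coeff_one_add_pow_sub d n hv (constantCoeff_trunc_eq_zero n hv)
    (X_pow_dvd_sub_trunc n v)
  rw [map_sub, map_sub, Polynomial.coeff_coe, coeff_trunc, if_neg (lt_irrefl n), sub_zero] at this
  rw [← this]; ring

end Formal

/-! ### Gauss-norm estimates -/

section Gauss

variable {K : Type*} [NormedField K]

/-- The Gauss norm of `f` at radius `ρ` is at most `M`. A bound on all coefficients, rather than on
Mathlib's `PowerSeries.gaussNorm`, whose supremum has a junk value when it is infinite. -/
def GaussLe (ρ M : ℝ) (f : K⟦X⟧) : Prop := ∀ n, ‖coeff n f‖ * ρ ^ n ≤ M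

namespace GaussLe

variable {ρ M M' : ℝ} {f g : K⟦X⟧}

theorem nonneg (hf : GaussLe ρ M f) : 0 ≤ M := by
  have := hf 0
  simp only [pow_zero, mul_one] at this
  exact (norm_nonneg _).trans this

theorem mono (hf : GaussLe ρ M f) (h : M ≤ M') : GaussLe ρ M' f := fun n => (hf n).trans h

theorem neg (hf : GaussLe ρ M f) : GaussLe ρ M (-f) := fun n => by simpa using hf n

theorem zero (hM : 0 ≤ M) : GaussLe ρ M (0 : K⟦X⟧) := fun n => by simpa using hM

theorem one : GaussLe ρ 1 (1 : K⟦X⟧) := fun n => by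
  rw [coeff_one]; split_ifs with h <;> simp [h]

theorem C_mul (hf : GaussLe ρ M f) (a : K) : GaussLe ρ (‖a‖ * M) (C a * f) := fun n => by
  rw [coeff_C_mul, norm_mul, mul_assoc]
  exact mul_le_mul_of_nonneg_left (hf n) (norm_nonneg a)

theorem natCast_mul (hf : GaussLe ρ M f) (k : ℕ) : GaussLe ρ (‖(k : K)‖ * M) ((k : K⟦X⟧) * f) := by
  have := hf.C_mul (k : K)
  rwa [map_natCast] at this

theorem C_mul_X_pow (hρ : 0 ≤ ρ) (a : K) (k : ℕ) :
    GaussLe ρ (‖a‖ * ρ ^ k) (C a * X ^ k) := fun n => by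
  rw [coeff_C_mul, coeff_X_pow]
  split_ifs with h
  · simp [h]
  · simp only [mul_zero, norm_zero, zero_mul]; positivity

theorem of_C_mul {a : K} (ha : a ≠ 0) (h : GaussLe ρ (‖a‖ * M) (C a * f)) : GaussLe ρ M f :=
  fun n => by
    have := h n
    rw [coeff_C_mul, norm_mul, mul_assoc] at this
    exact le_of_mul_le_mul_left this (norm_pos_iff.2 ha)

theorem expand {d : ℕ} (hd : d ≠ 0) (hf : GaussLe (ρ ^ d) M f) :
    GaussLe ρ M (PowerSeries.expand d hd f) := fun n => by
  by_cases h : d ∣ n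
  · obtain ⟨m, rfl⟩ := h
    rw [coeff_expand_mul, pow_mul]; exact hf m
  · rw [coeff_expand_of_not_dvd d hd f h]; simpa using hf.nonneg

theorem trunc {n : ℕ} (hM : 0 ≤ M) (h : ∀ i < n, ‖coeff i f‖ * ρ ^ i ≤ M) :
    GaussLe ρ M (PowerSeries.trunc n f : K⟦X⟧) := fun i => by
  rw [Polynomial.coeff_coe, coeff_trunc]
  split_ifs with hi
  · exact h i hi
  · simpa using hM

variable [IsUltrametricDist K]

theorem add (hρ : 0 ≤ ρ) (hf : GaussLe ρ M f) (hg : GaussLe ρ M g) : GaussLe ρ M (f + g) :=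
  fun n => by
    rw [map_add]
    refine (mul_le_mul_of_nonneg_right (IsUltrametricDist.norm_add_le_max _ _)
      (pow_nonneg hρ n)).trans ?_
    rw [max_mul_of_nonneg _ _ (pow_nonneg hρ n)]
    exact max_le (hf n) (hg n)

theorem sub (hρ : 0 ≤ ρ) (hf : GaussLe ρ M f) (hg : GaussLe ρ M g) : GaussLe ρ M (f - g) := by
  rw [sub_eq_add_neg]; exact hf.add hρ hg.neg

theorem sum {ι : Type*} (hρ : 0 ≤ ρ) (hM : 0 ≤ M) (s : Finset ι) {F : ι → K⟦X⟧}
    (h : ∀ i ∈ s, GaussLe ρ M (F i)) : GaussLe ρ M (∑ i ∈ s, F i) :=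
  Finset.sum_induction F (GaussLe ρ M) (fun _ _ ha hb => ha.add hρ hb) (zero hM) h

theorem mul (hρ : 0 ≤ ρ) (hf : GaussLe ρ M f) (hg : GaussLe ρ M' g) :
    GaussLe ρ (M * M') (f * g) := fun n => by
  rw [coeff_mul]
  have hb : ∀ x ∈ Finset.HasAntidiagonal.antidiagonal n,
      ‖coeff x.1 f * coeff x.2 g‖ * ρ ^ n ≤ M * M' := by
    intro x hx
    rw [Finset.HasAntidiagonal.mem_antidiagonal] at hx
    rw [← hx, pow_add, norm_mul, mul_mul_mul_comm]
    exact mul_le_mul (hf _) (hg _) (by positivity) hf.nonneg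
  obtain ⟨i, hi, hle⟩ := IsUltrametricDist.exists_norm_finsetSum_le
    (Finset.HasAntidiagonal.antidiagonal n) (fun x => coeff x.1 f * coeff x.2 g)
  exact (mul_le_mul_of_nonneg_right hle (pow_nonneg hρ n)).trans
    (hb i (hi ⟨(0, n), by simp⟩))

theorem pow (hρ : 0 ≤ ρ) (hf : GaussLe ρ M f) (k : ℕ) : GaussLe ρ (M ^ k) (f ^ k) := by
  induction k with
  | zero => simpa using one
  | succ k ih => rw [pow_succ, pow_succ]; exact ih.mul hρ hf

theorem pow_sub_pow (hρ : 0 ≤ ρ) {η : ℝ} (hf : GaussLe ρ M f) (hg : GaussLe ρ M g)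
    (hfg : GaussLe ρ η (f - g)) (k : ℕ) : GaussLe ρ (η * M ^ (k - 1)) (f ^ k - g ^ k) := by
  rw [← geom_sum₂_mul, mul_comm η]
  refine mul hρ (sum hρ (pow_nonneg hf.nonneg _) _ fun i hi => ?_) hfg
  have : k - 1 = i + (k - 1 - i) := by have := Finset.mem_range.1 hi; lia
  rw [this, pow_add, ← this]
  exact (hf.pow hρ _).mul hρ (hg.pow hρ _)

end GaussLe

variable [IsUltrametricDist K]

/-- The linear term of `(1 + v) ^ d - (1 + w) ^ d` dominates the others on series of Gauss norm at
most `q`, as soon as `‖d.choose k‖ * q ^ (k - 1) ≤ ‖d‖` for all `k ≥ 1`; the factor `ε` is the gain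
on series of norm at most `q * ε`. -/
theorem GaussLe.one_add_pow_sub {d : ℕ} (hd : 1 ≤ d) {q : ℝ}
    (hc : ∀ k, 1 ≤ k → ‖(d.choose k : K)‖ * q ^ (k - 1) ≤ ‖(d : K)‖)
    {ρ η ε : ℝ} (hρ : 0 ≤ ρ) (hε : 0 ≤ ε) (hε1 : ε ≤ 1) {v w : K⟦X⟧}
    (hv : GaussLe ρ (q * ε) v) (hw : GaussLe ρ (q * ε) w) (hvw : GaussLe ρ η (v - w)) :
    GaussLe ρ (‖(d : K)‖ * (η * ε)) ((1 + v) ^ d - (1 + w) ^ d - (d : K⟦X⟧) * (v - w)) := by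
  have hη := hvw.nonneg
  have e : (1 + v) ^ d - (1 + w) ^ d - d * (v - w)
      = ∑ k ∈ (Finset.range (d + 1)).erase 1, (d.choose k : K⟦X⟧) * (v ^ k - w ^ k) := by
    rw [sub_eq_iff_eq_add']
    have h1 : (1 : ℕ) ∈ Finset.range (d + 1) := by simp; lia
    have := Finset.add_sum_erase _ (fun k => (d.choose k : K⟦X⟧) * (v ^ k - w ^ k)) h1
    simp only [Nat.choose_one_right, pow_one] at this
    rw [this, add_comm 1 v, add_comm 1 w, add_pow, add_pow, ← Finset.sum_sub_distrib]
    refine Finset.sum_congr rfl fun k _ => ?_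
    simp only [one_pow]; ring
  rw [e]
  refine sum hρ (by positivity) _ fun k hk => ?_
  obtain _ | _ | k := k
  · simpa using zero (by positivity)
  · simp at hk
  · refine ((hv.pow_sub_pow hρ hw hvw (k + 2)).natCast_mul (d.choose (k + 2))).mono ?_
    have := hc (k + 2) (by lia)
    simp only [Nat.add_succ_sub_one] at this ⊢
    calc ‖(d.choose (k + 2) : K)‖ * (η * (q * ε) ^ (k + 1))
        = (‖(d.choose (k + 2) : K)‖ * q ^ (k + 1)) * (η * ε ^ (k + 1)) := by ring
      _ ≤ ‖(d : K)‖ * (η * ε) := by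
        refine mul_le_mul this ?_ (by positivity) (norm_nonneg _)
        exact mul_le_mul_of_nonneg_left (pow_le_of_le_one hε hε1 (by lia)) hη

/-- One step of the coefficientwise extraction of a `d`-th root: a bound for
`(1 + v) ^ d - (1 + w) ^ d` in degree `n` gives one for `v - w`, once the lower coefficients are
under control. -/
theorem norm_coeff_sub_le {d : ℕ} (hd : (d : K) ≠ 0) {q : ℝ} (hq : 0 ≤ q)
    (hc : ∀ k, 1 ≤ k → ‖(d.choose k : K)‖ * q ^ (k - 1) ≤ ‖(d : K)‖)
    {ρ η : ℝ} (hρ : 0 ≤ ρ) (hη : 0 ≤ η) {v w : K⟦X⟧} (hv0 : constantCoeff v = 0)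
    (hw0 : constantCoeff w = 0) (n : ℕ)
    (hv : ∀ i < n, ‖coeff i v‖ * ρ ^ i ≤ q) (hw : ∀ i < n, ‖coeff i w‖ * ρ ^ i ≤ q)
    (hvw : ∀ i < n, ‖coeff i (v - w)‖ * ρ ^ i ≤ η)
    (h : ‖coeff n ((1 + v) ^ d - (1 + w) ^ d)‖ * ρ ^ n ≤ ‖(d : K)‖ * η) :
    ‖coeff n (v - w)‖ * ρ ^ n ≤ η := by
  have hd1 : 1 ≤ d := by
    rcases Nat.eq_zero_or_pos d with h0 | h0
    · exact absurd (by simp [h0]) hd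
    · exact h0
  have ht := GaussLe.trunc hη hvw
  have key := GaussLe.one_add_pow_sub hd1 hc hρ zero_le_one le_rfl
    (v := (trunc n v : K⟦X⟧)) (w := (trunc n w : K⟦X⟧)) (η := η)
    (by simpa using GaussLe.trunc hq hv) (by simpa using GaussLe.trunc hq hw)
    (by simpa [trunc_sub] using ht) n
  -- The left side of `key` agrees in degree `n` with the same expression in `v` and `w`, up to the
  -- linear term `d * (v - w)`, which the truncations do not have in this degree.
  have h0 : coeff n ((d : K⟦X⟧) * ((trunc n v : K⟦X⟧) - (trunc n w : K⟦X⟧))) = 0 := by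
    rw [← map_natCast (C (R := K)), coeff_C_mul]
    simp [coeff_trunc]
  have e : (d : K) * coeff n (v - w) = coeff n ((1 + v) ^ d - (1 + w) ^ d)
      - coeff n ((1 + (trunc n v : K⟦X⟧)) ^ d - (1 + (trunc n w : K⟦X⟧)) ^ d
        - (d : K⟦X⟧) * ((trunc n v : K⟦X⟧) - (trunc n w : K⟦X⟧))) := by
    rw [map_sub _ _ (_ * _), h0]
    simp only [map_sub, coeff_one_add_pow_eq d n hv0, coeff_one_add_pow_eq d n hw0]
    ring
  refine le_of_mul_le_mul_left ?_ (norm_pos_iff.2 hd)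
  rw [← mul_assoc, ← norm_mul, e, sub_eq_add_neg]
  refine (mul_le_mul_of_nonneg_right (IsUltrametricDist.norm_add_le_max _ _)
    (pow_nonneg hρ n)).trans ?_
  rw [max_mul_of_nonneg _ _ (pow_nonneg hρ n), norm_neg]
  exact max_le h (by simpa using key)

end Gauss

/-! ### Absolute values of factorials, binomial coefficients and binomial series -/

section Padic

variable (p : ℕ) [Fact p.Prime]

/-- The number `p ^ (-1 / (p - 1))`, the radius of convergence of the `p`-adic exponential. -/
noncomputable def expRadius (p : ℕ) : ℝ := (p : ℝ) ^ (-(1 / ((p : ℝ) - 1)))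

theorem one_lt_natCast_prime : (1 : ℝ) < p := by exact_mod_cast (Fact.out : p.Prime).one_lt

theorem expRadius_pos : 0 < expRadius p :=
  Real.rpow_pos_of_pos (zero_lt_one.trans (one_lt_natCast_prime p)) _

theorem expRadius_lt_one : expRadius p < 1 :=
  Real.rpow_lt_one_of_one_lt_of_neg (one_lt_natCast_prime p)
    (neg_neg_of_pos (one_div_pos.2 (sub_pos.2 (one_lt_natCast_prime p))))

theorem norm_natCast_eq {n : ℕ} (hn : n ≠ 0) :
    ‖(n : ℂ_[p])‖ = (p : ℝ) ^ (-(padicValNat p n : ℝ)) := by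
  have : ‖(n : ℂ_[p])‖ = ‖(n : ℚ_[p])‖ := by
    rw [← map_natCast (algebraMap ℚ_[p] ℂ_[p]) n, norm_algebraMap']
  rw [this, Padic.norm_eq_zpow_neg_valuation (by exact_mod_cast hn), Padic.valuation_natCast,
    ← Real.rpow_intCast]
  simp

theorem norm_natCast_le_one (n : ℕ) : ‖(n : ℂ_[p])‖ ≤ 1 :=
  IsUltrametricDist.norm_natCast_le_one _ n

theorem norm_natCast_pos {n : ℕ} (hn : n ≠ 0) : 0 < ‖(n : ℂ_[p])‖ :=
  norm_pos_iff.2 (by exact_mod_cast hn)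

theorem norm_natCast_lt_one {n : ℕ} (hn : n ≠ 0) (h : p ∣ n) : ‖(n : ℂ_[p])‖ < 1 := by
  rw [norm_natCast_eq p hn]
  refine Real.rpow_lt_one_of_one_lt_of_neg (one_lt_natCast_prime p) (neg_neg_of_pos ?_)
  exact_mod_cast Nat.pos_of_ne_zero (dvd_iff_padicValNat_ne_zero hn |>.1 h)

omit [Fact p.Prime] in
theorem expRadius_pow (n : ℕ) : expRadius p ^ n = (p : ℝ) ^ (-(n / ((p : ℝ) - 1))) := by
  rw [expRadius, ← Real.rpow_natCast, ← Real.rpow_mul (Nat.cast_nonneg p)]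
  congr 1; ring

theorem expRadius_mul_norm_factorial (n : ℕ) : expRadius p * ‖((n.factorial : ℕ) : ℂ_[p])‖
    = (p : ℝ) ^ (-((1 + ((p - 1 : ℕ) * padicValNat p n.factorial : ℕ)) / ((p : ℝ) - 1))) := by
  have h1 := one_lt_natCast_prime p
  rw [norm_natCast_eq p n.factorial_ne_zero, expRadius, ← Real.rpow_add (by linarith)]
  congr 1
  have h2 : ((p - 1 : ℕ) : ℝ) = p - 1 := by
    rw [Nat.cast_sub (Fact.out : p.Prime).one_le, Nat.cast_one]
  have : (p : ℝ) - 1 ≠ 0 := by linarith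
  rw [Nat.cast_mul, h2]
  field_simp
  ring

/-- Legendre's formula `(p - 1) * v_p(n!) = n - s_p(n)`, with a digit sum `s_p(n)` at least `1`. -/
theorem expRadius_pow_le {n : ℕ} (hn : n ≠ 0) :
    expRadius p ^ n ≤ expRadius p * ‖((n.factorial : ℕ) : ℂ_[p])‖ := by
  have h1 := one_lt_natCast_prime p
  rw [expRadius_mul_norm_factorial, expRadius_pow]
  refine Real.rpow_le_rpow_of_exponent_le h1.le (neg_le_neg ?_)
  refine div_le_div_of_nonneg_right ?_ (by linarith)
  have := sub_one_mul_padicValNat_factorial_lt_of_ne_zero p hn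
  exact_mod_cast (by lia : 1 + (p - 1) * padicValNat p n.factorial ≤ n)

theorem expRadius_pow_prime_pow (k : ℕ) :
    expRadius p ^ p ^ k = expRadius p * ‖(((p ^ k).factorial : ℕ) : ℂ_[p])‖ := by
  have hp : p.Prime := Fact.out
  rw [expRadius_mul_norm_factorial, expRadius_pow, sub_one_mul_padicValNat_factorial]
  have h : (Nat.digits p (p ^ k)).sum = 1 := by
    have := Nat.digits_base_pow_mul (b := p) (k := k) (m := 1) hp.one_lt one_pos
    rw [mul_one] at this
    rw [this, Nat.digits_of_lt p 1 one_ne_zero hp.one_lt]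
    simp
  have h2 := Nat.one_le_pow k p hp.pos
  rw [h, Nat.cast_sub h2]
  push_cast
  congr 3
  ring

theorem norm_choose_mul_expRadius_pow_le (d k : ℕ) (hk : 1 ≤ k) :
    ‖(d.choose k : ℂ_[p])‖ * expRadius p ^ (k - 1) ≤ ‖(d : ℂ_[p])‖ := by
  obtain ⟨k, rfl⟩ : ∃ j, k = j + 1 := ⟨k - 1, by lia⟩
  obtain _ | d := d
  · simp
  have hq := expRadius_pos p
  have h1 : expRadius p ^ k ≤ ‖((k + 1 : ℕ) : ℂ_[p])‖ := by
    have := expRadius_pow_le p k.succ_ne_zero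
    rw [pow_succ', Nat.factorial_succ, Nat.cast_mul, norm_mul] at this
    refine (le_of_mul_le_mul_left this hq).trans ?_
    exact mul_le_of_le_one_right (norm_nonneg _) (norm_natCast_le_one p _)
  have h2 : ‖((d + 1 : ℕ) : ℂ_[p])‖ * ‖(d.choose k : ℂ_[p])‖
      = ‖((d + 1).choose (k + 1) : ℂ_[p])‖ * ‖((k + 1 : ℕ) : ℂ_[p])‖ := by
    rw [← norm_mul, ← norm_mul]
    exact_mod_cast congrArg (fun m : ℕ => ‖(m : ℂ_[p])‖) (Nat.add_one_mul_choose_eq d k)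
  rw [Nat.add_sub_cancel]
  refine (mul_le_mul_of_nonneg_left h1 (norm_nonneg _)).trans ?_
  rw [← h2]
  exact mul_le_of_le_one_right (norm_nonneg _) (norm_natCast_le_one p _)

/-- The binomial series `(1 + X) ^ (1 / d)` over `ℂ_[p]`. -/
noncomputable def rootSeries (d : ℕ) : ℂ_[p]⟦X⟧ :=
  PowerSeries.map (Rat.castHom ℂ_[p]) (PowerSeries.binomialSeries ℚ (1 / d : ℚ))

theorem rootSeries_pow {d : ℕ} (hd : d ≠ 0) : rootSeries p d ^ d = 1 + X := by
  have h (n : ℕ) : PowerSeries.binomialSeries ℚ (1 / d : ℚ) ^ n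
      = PowerSeries.binomialSeries ℚ (n * (1 / d) : ℚ) := by
    induction n with
    | zero => simp
    | succ n ih =>
      rw [pow_succ, ih, ← binomialSeries_add]
      push_cast; congr 1; ring
  have h1 := binomialSeries_nat (R := ℚ) (A := ℚ) 1
  rw [rootSeries, ← map_pow, h, mul_one_div_cancel (by exact_mod_cast hd)]
  rw [Nat.cast_one, pow_one] at h1
  rw [h1, map_add, map_one, map_X]

/-- The `n`-th coefficient is `∏ (1 - i d) / (d ^ n * n!)`, and its numerator is a unit. -/
theorem norm_coeff_rootSeries {d : ℕ} (hd : d ≠ 0) (hpd : p ∣ d) (n : ℕ) :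
    ‖coeff n (rootSeries p d)‖ * (‖(d : ℂ_[p])‖ ^ n * ‖((n.factorial : ℕ) : ℂ_[p])‖) = 1 := by
  have h1 : (n.factorial : ℚ) * Ring.choose (1 / d : ℚ) n * (d : ℚ) ^ n
      = ((∏ i ∈ Finset.range n, (1 - i * d : ℤ) : ℤ) : ℚ) := by
    have := Ring.descPochhammer_eq_factorial_smul_choose (1 / d : ℚ) n
    rw [nsmul_eq_mul, ← Polynomial.aeval_eq_smeval, Polynomial.aeval_def,
      Polynomial.eval₂_eq_eval_map, descPochhammer_map, descPochhammer_eval_eq_prod_range] at this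
    have hd' : (d : ℚ) ≠ 0 := by exact_mod_cast hd
    have h := Finset.prod_mul_pow_card (s := Finset.range n) (f := fun j => (1 / d : ℚ) - j)
      (b := (d : ℚ))
    rw [Finset.card_range] at h
    rw [← this, Int.cast_prod, h]
    refine Finset.prod_congr rfl fun i _ => ?_
    push_cast
    field_simp
  have h2 (i : ℕ) : ‖((1 - i * d : ℤ) : ℂ_[p])‖ = 1 := by
    have h3 : ‖((i * d : ℕ) : ℂ_[p])‖ < 1 := by
      rw [Nat.cast_mul, norm_mul]
      exact mul_lt_one_of_nonneg_of_lt_one_right (norm_natCast_le_one p i) (norm_nonneg _)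
        (norm_natCast_lt_one p hd hpd)
    have := IsUltrametricDist.norm_add_eq_max_of_norm_ne_norm (x := (1 : ℂ_[p]))
      (y := -((i * d : ℕ) : ℂ_[p])) (by rw [norm_neg, norm_one]; exact h3.ne')
    rw [norm_neg, norm_one, max_eq_left h3.le] at this
    rw [← this]; push_cast; congr 1; ring
  have h4 := congrArg (fun r : ℚ => ‖(r : ℂ_[p])‖) h1
  simp only [Rat.cast_mul, Rat.cast_natCast, Rat.cast_pow, Rat.cast_intCast, norm_mul,
    norm_pow] at h4
  rw [Int.cast_prod, norm_prod, Finset.prod_congr rfl fun i _ => h2 i, Finset.prod_const_one] at h4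
  rw [rootSeries, coeff_map, binomialSeries_coeff, ← h4, smul_eq_mul, mul_one, Rat.coe_castHom]
  ring

/-- The coefficients of `(1 + α X ^ D) ^ (1 / d)` at the radius `ρ` where `‖α‖ * ρ ^ D` is
`q * ‖d‖`, for `q = expRadius p`: they are bounded by `q` in positive degrees, with equality in the
degrees `D * p ^ k`. -/
theorem exists_root_one_add {d D : ℕ} (hd : d ≠ 0) (hpd : p ∣ d) (hD : D ≠ 0) (α : ℂ_[p]) {ρ : ℝ}
    (hα : ‖α‖ * ρ ^ D = expRadius p * ‖(d : ℂ_[p])‖) :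
    ∃ w : ℂ_[p]⟦X⟧, constantCoeff w = 0 ∧ (1 + w) ^ d = 1 + C α * X ^ D ∧
      GaussLe ρ (expRadius p) w ∧
      ∀ k, ‖coeff (D * p ^ k) w‖ * ρ ^ (D * p ^ k) = expRadius p := by
  set B : ℂ_[p]⟦X⟧ := PowerSeries.expand D hD (rescale α (rootSeries p d)) with hB
  have hB0 : constantCoeff B = 1 := by
    rw [hB, constantCoeff_expand, ← coeff_zero_eq_constantCoeff_apply, coeff_rescale]
    simp [rootSeries]
  have hc (n : ℕ) : ‖coeff (D * n) B‖ * ρ ^ (D * n) * ‖((n.factorial : ℕ) : ℂ_[p])‖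
      = expRadius p ^ n := by
    have hdn := pow_pos (norm_natCast_pos p hd) n
    have h1 := norm_coeff_rootSeries p hd hpd n
    rw [hB, coeff_expand_mul, coeff_rescale, norm_mul, norm_pow, pow_mul]
    have h2 : (‖α‖ * ρ ^ D) ^ n = (expRadius p * ‖(d : ℂ_[p])‖) ^ n := by rw [hα]
    rw [mul_pow, mul_pow] at h2
    calc _ = ‖α‖ ^ n * (ρ ^ D) ^ n *
          (‖coeff n (rootSeries p d)‖ * ‖((n.factorial : ℕ) : ℂ_[p])‖) := by ring
      _ = expRadius p ^ n *
          (‖coeff n (rootSeries p d)‖ *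
            (‖(d : ℂ_[p])‖ ^ n * ‖((n.factorial : ℕ) : ℂ_[p])‖)) := by rw [h2]; ring
      _ = _ := by rw [h1, mul_one]
  have hcw (n : ℕ) (hn : n ≠ 0) : coeff n (B - 1) = coeff n B := by
    rw [map_sub, coeff_one, if_neg hn, sub_zero]
  have hf (n : ℕ) : 0 < ‖((n.factorial : ℕ) : ℂ_[p])‖ := norm_natCast_pos p n.factorial_ne_zero
  refine ⟨B - 1, by simp [hB0], ?_, fun n => ?_, fun k => ?_⟩
  · rw [add_sub_cancel, hB, ← map_pow, ← map_pow, rootSeries_pow p hd, map_add, map_one, map_add,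
      map_one, rescale_X, map_mul, expand_C, expand_X]
  · rcases eq_or_ne n 0 with rfl | hn
    · simp [hB0, (expRadius_pos p).le]
    rw [hcw n hn]
    by_cases hDn : D ∣ n
    · obtain ⟨m, rfl⟩ := hDn
      have hm : m ≠ 0 := by rintro rfl; simp at hn
      refine le_of_mul_le_mul_right ?_ (hf m)
      rw [hc]; exact expRadius_pow_le p hm
    · rw [hB, coeff_expand_of_not_dvd D hD _ hDn]; simpa using (expRadius_pos p).le
  · have hk : D * p ^ k ≠ 0 := mul_ne_zero hD (pow_ne_zero _ (Fact.out : p.Prime).ne_zero)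
    rw [hcw _ hk]
    refine mul_right_cancel₀ (hf (p ^ k)).ne' ?_
    rw [hc, expRadius_pow_prime_pow]

end Padic

/-! ### Coefficients of the inverse Böttcher series -/

section Root

variable {p : ℕ} [Fact p.Prime] {d : ℕ} {c : ℂ_[p]} {v : ℂ_[p]⟦X⟧} {R : ℝ}

/-- A family of bounds `M j` at the radii `R ^ (d ^ j)` which is compatible with the equation
`(1 + v) ^ d = 1 + v(X ^ d) + c X` is satisfied by its solution: the bound at `R ^ (d ^ (j + 1))`
for lower coefficients of `v` yields the bound at `R ^ (d ^ j)` for `v(X ^ d)`. -/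
theorem gaussLe_of_functional_eq (hd : 2 ≤ d) (hR : 0 ≤ R) (hv0 : constantCoeff v = 0)
    (hv : (1 + v) ^ d = 1 + (PowerSeries.expand d (by lia) v + C c * X)) {M : ℕ → ℝ}
    (hM0 : ∀ j, 0 ≤ M j) (hMq : ∀ j, M j ≤ expRadius p)
    (hc : ∀ j, ‖c‖ * R ^ d ^ j ≤ ‖(d : ℂ_[p])‖ * M j)
    (hM : ∀ j, M (j + 1) ≤ ‖(d : ℂ_[p])‖ * M j) (j : ℕ) : GaussLe (R ^ d ^ j) (M j) v := by
  intro n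
  induction n using Nat.strong_induction_on generalizing j with
  | _ n ih =>
    have hρ : 0 ≤ R ^ d ^ j := pow_nonneg hR _
    have hdM : 0 ≤ ‖(d : ℂ_[p])‖ * M j := mul_nonneg (norm_nonneg _) (hM0 j)
    have := norm_coeff_sub_le (q := expRadius p) (η := M j) (d := d) (v := v) (w := 0)
      (by exact_mod_cast (by lia : d ≠ 0)) (expRadius_pos p).le
      (norm_choose_mul_expRadius_pow_le p d) hρ (hM0 j) hv0 (map_zero _) n
      (fun i hi => (ih i hi j).trans (hMq j)) (fun i _ => by simpa using (expRadius_pos p).le)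
      (fun i hi => by simpa using ih i hi j) ?_
    · simpa using this
    rw [add_zero, one_pow, hv, add_sub_cancel_left, map_add]
    refine (mul_le_mul_of_nonneg_right (IsUltrametricDist.norm_add_le_max _ _)
      (pow_nonneg hρ n)).trans ?_
    rw [max_mul_of_nonneg _ _ (pow_nonneg hρ n)]
    refine max_le ?_ ?_
    · by_cases hdn : d ∣ n
      · obtain ⟨m, rfl⟩ := hdn
        rw [coeff_expand_mul, pow_mul]
        rcases Nat.eq_zero_or_pos m with rfl | hm
        · simpa [hv0] using hdM
        have := ih m (by nlinarith) (j + 1)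
        rw [pow_succ, pow_mul] at this
        exact this.trans (hM j)
      · rw [coeff_expand_of_not_dvd d _ v hdn]; simpa using hdM
    · have := GaussLe.C_mul_X_pow hρ c 1 n
      rw [pow_one, pow_one] at this
      exact this.trans (hc j)

/-- Here `‖c‖ * R ^ (d ^ j)`, compared with `q * ‖d‖ ^ (j + 1)` for `q = expRadius p`, has a unique
peak at `j = N`. Then, at the radius `R`, the solution `1 + v` is close to the `d`-th root of
`1 + (c / d ^ N) X ^ (d ^ N)`, whose coefficients of degree `d ^ N * p ^ k` have size exactly
`q`. -/
theorem norm_coeff_of_functional_eq (hd : 2 ≤ d) (hpd : p ∣ d) (hR : 0 < R)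
    (hv0 : constantCoeff v = 0)
    (hv : (1 + v) ^ d = 1 + (PowerSeries.expand d (by lia) v + C c * X)) {N : ℕ} {δ : ℝ}
    (hδ1 : δ < 1) (hdδ : ‖(d : ℂ_[p])‖ ≤ δ)
    (hN : ‖c‖ * R ^ d ^ N = expRadius p * ‖(d : ℂ_[p])‖ ^ (N + 1))
    (hj : ∀ j, j ≠ N → ‖c‖ * R ^ d ^ j ≤ δ * (expRadius p * ‖(d : ℂ_[p])‖ ^ (j + 1))) :
    GaussLe R (expRadius p) v ∧
      ∀ k, ‖coeff (d ^ N * p ^ k) v‖ * R ^ (d ^ N * p ^ k) = expRadius p := by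
  have hd0 : d ≠ 0 := by lia
  have hdK : (d : ℂ_[p]) ≠ 0 := by exact_mod_cast hd0
  set q := expRadius p with hq
  have hq0 : 0 < q := expRadius_pos p
  set e := ‖(d : ℂ_[p])‖ with he
  have he0 : 0 < e := norm_natCast_pos p hd0
  have he1 : e < 1 := norm_natCast_lt_one p hd0 hpd
  have hδ0 : 0 < δ := he0.trans_le hdδ
  have hρ (j : ℕ) : 0 ≤ R ^ d ^ j := pow_nonneg hR.le _
  -- The bounds `q * ‖d‖ ^ j` are improved by the factor `δ` beyond `N`, where the term `c X` does
  -- not reach them.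
  let M : ℕ → ℝ := fun j => (if j ≤ N then 1 else δ) * (q * e ^ j)
  have hM := gaussLe_of_functional_eq (M := M) hd hR.le hv0 hv
    (fun j => by simp only [M]; split_ifs <;> positivity)
    (fun j => by
      have h1 : q * e ^ j ≤ q := mul_le_of_le_one_right hq0.le (pow_le_one₀ he0.le he1.le)
      have h2 : (if j ≤ N then 1 else δ) ≤ 1 := by split_ifs <;> linarith
      exact (mul_le_of_le_one_left (by positivity) h2).trans h1)
    (fun j => by
      have h1 : ‖(d : ℂ_[p])‖ * M j = (if j ≤ N then 1 else δ) * (q * e ^ (j + 1)) := by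
        simp only [M]; ring
      rw [h1]
      rcases eq_or_ne j N with rfl | hjN
      · simpa using hN.le
      · refine (hj j hjN).trans (mul_le_mul_of_nonneg_right ?_ (by positivity))
        split_ifs <;> linarith)
    (fun j => by
      have h1 : ‖(d : ℂ_[p])‖ * M j = (if j ≤ N then 1 else δ) * (q * e ^ (j + 1)) := by
        simp only [M]; ring
      rw [h1]
      refine mul_le_mul_of_nonneg_right ?_ (by positivity)
      split_ifs <;> first | lia | linarith)
  have hMle (j : ℕ) (hjN : j ≤ N) : GaussLe (R ^ d ^ j) (q * e ^ j) v := by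
    simpa [M, hjN] using hM j
  -- The dominant term of `v(X ^ d) + c X` at the radius `R ^ (d ^ j)`, by descending induction.
  have main : ∀ i j, i + j = N → GaussLe (R ^ d ^ j) (δ * (q * e ^ (j + 1)))
      (PowerSeries.expand d hd0 v + C c * X - C (c / d ^ i) * X ^ d ^ i) := by
    intro i
    induction i with
    | zero =>
      rintro j rfl
      have h1 := hM (0 + j + 1)
      simp only [M, if_neg (Nat.not_succ_le_self (0 + j))] at h1
      rw [pow_succ, pow_mul, zero_add] at h1
      simpa using h1.expand hd0
    | succ i ih =>
      intro j hij
      have hjN : j ≠ N := by lia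
      have h1 := ih (j + 1) (by lia)
      have h2 := GaussLe.one_add_pow_sub (d := d) (q := q) (ε := e) (by lia)
        (norm_choose_mul_expRadius_pow_le p d) (hρ (j + 1)) he0.le he1.le (v := v) (w := 0)
        (η := q * e ^ (j + 1))
        ((hMle (j + 1) (by lia)).mono (mul_le_mul_of_nonneg_left
          (pow_le_of_le_one he0.le he1.le (by lia)) hq0.le))
        (GaussLe.zero (by positivity))
        (by simpa using hMle (j + 1) (by lia))
      have h3 : GaussLe (R ^ d ^ (j + 1)) (δ * (q * e ^ (j + 1)))
          (v - C (c / d ^ (i + 1)) * X ^ d ^ i) := by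
        refine GaussLe.of_C_mul hdK ?_
        have h4 : C (d : ℂ_[p]) * (v - C (c / d ^ (i + 1)) * X ^ d ^ i)
            = (PowerSeries.expand d hd0 v + C c * X - C (c / d ^ i) * X ^ d ^ i)
              - ((1 + v) ^ d - (1 + 0) ^ d - (d : ℂ_[p]⟦X⟧) * (v - 0)) := by
          rw [hv, mul_sub, ← mul_assoc, ← map_mul, mul_div_assoc', pow_succ' (d : ℂ_[p]),
            mul_div_mul_left _ _ hdK, map_natCast]
          simp only [add_zero, one_pow, sub_zero]
          ring
        rw [h4]
        refine (h1.mono ?_).sub (hρ _) (h2.mono ?_)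
        · rw [pow_succ e (j + 1)]; exact le_of_eq (by ring)
        · refine mul_le_mul_of_nonneg_left ?_ he0.le
          rw [mul_comm]
          exact mul_le_mul_of_nonneg_right hdδ (by positivity)
      rw [pow_succ, pow_mul] at h3
      have h5 := h3.expand hd0
      have h6 : GaussLe (R ^ d ^ j) (δ * (q * e ^ (j + 1))) (C c * X) := by
        have := GaussLe.C_mul_X_pow (hρ j) c 1
        rw [pow_one, pow_one] at this
        exact this.mono (hj j hjN)
      have h7 := h5.add (hρ j) h6
      rw [map_sub, map_mul, map_pow, expand_C, expand_X, ← pow_mul, ← pow_succ'] at h7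
      convert h7 using 1
      ring
  have h0 := main N 0 rfl
  rw [pow_zero, pow_one, zero_add, pow_one] at h0
  have hα : ‖c / (d : ℂ_[p]) ^ N‖ * R ^ d ^ N = q * e := by
    rw [norm_div, norm_pow, div_mul_eq_mul_div, hN, ← he, pow_succ, ← mul_assoc,
      mul_right_comm, mul_div_assoc, div_self (pow_ne_zero N he0.ne'), mul_one]
  obtain ⟨w, hw0, hw, hwq, hweq⟩ :=
    exists_root_one_add p hd0 hpd (pow_ne_zero N hd0) (c / (d : ℂ_[p]) ^ N) hα
  have hvq : GaussLe R q v := by simpa using hMle 0 (Nat.zero_le N)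
  have hvw (n : ℕ) : ‖coeff n (v - w)‖ * R ^ n ≤ δ * q := by
    induction n using Nat.strong_induction_on with
    | _ n ih =>
      refine norm_coeff_sub_le hdK hq0.le (norm_choose_mul_expRadius_pow_le p d) hR.le
        (by positivity) hv0 hw0 n (fun i _ => hvq i) (fun i _ => hwq i) ih ?_
      have := h0 n
      rw [hv, hw, add_sub_add_left_eq_sub]
      exact this.trans (le_of_eq (by ring))
  refine ⟨hvq, fun k => ?_⟩
  set n := d ^ N * p ^ k
  have hRn : 0 < R ^ n := pow_pos hR n
  have hlt : ‖coeff n (v - w)‖ < ‖coeff n w‖ := by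
    refine lt_of_mul_lt_mul_right ?_ hRn.le
    rw [hweq k]
    exact (hvw n).trans_lt (mul_lt_of_lt_one_left hq0 hδ1)
  have : coeff n v = coeff n (v - w) + coeff n w := by rw [map_sub, sub_add_cancel]
  rw [this, IsUltrametricDist.norm_add_eq_max_of_norm_ne_norm hlt.ne, max_eq_right hlt.le, hweq k]

end Root

/-! ### The compositional inverse at infinity -/

section FormalInverse

variable {K : Type*} [Field K] {E G : K⟦X⟧}

theorem hasSubst_X_mul (f : K⟦X⟧) : HasSubst (X * f) :=
  HasSubst.of_constantCoeff_zero' (by simp)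

theorem mul_inv_cancel_of_one (hE : constantCoeff E = 1) : E * E⁻¹ = 1 :=
  PowerSeries.mul_inv_cancel E (by simp [hE])

theorem constantCoeff_subst_X_mul (f g : K⟦X⟧) :
    constantCoeff (subst (X * f) g : K⟦X⟧) = constantCoeff g := by
  have h : subst (X * f) g
      = subst (X * f) (g - C (constantCoeff g)) + (C (constantCoeff g) : K⟦X⟧) := by
    rw [subst_sub (hasSubst_X_mul f), subst_C]
    exact (sub_add_cancel _ _).symm
  rw [h, map_add, constantCoeff_C]
  have := constantCoeff_subst_eq_zero (a := X * f)
    (show PowerSeries.constantCoeff (X * f) = 0 by simp) (g - C (constantCoeff g)) (by simp)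
  erw [this, zero_add]

/-- The equation `E * G(X / E) = 1` is triangular in the coefficients of `G`, with `1` on the
diagonal. -/
theorem coeff_mul_subst_sub (hE : constantCoeff E = 1) {n : ℕ} {f g : K⟦X⟧} (h : X ^ n ∣ f - g) :
    coeff n (E * subst (X * E⁻¹) f) - coeff n (E * subst (X * E⁻¹) g) = coeff n (f - g) := by
  obtain ⟨r, hr⟩ := h
  have hs := hasSubst_X_mul E⁻¹
  have h0 (f : K⟦X⟧) : coeff n (X ^ n * f) = constantCoeff f := by
    have := coeff_X_pow_mul f n 0
    simpa using this
  have hE' : constantCoeff E⁻¹ = 1 := by rw [constantCoeff_inv, hE, inv_one]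
  rw [← map_sub, ← mul_sub, ← subst_sub hs, hr, h0, subst_mul hs, subst_pow hs, subst_X hs]
  have e : E * ((X * E⁻¹) ^ n * subst (X * E⁻¹) r)
      = X ^ n * (E * (E⁻¹ ^ n * subst (X * E⁻¹) r)) := by ring
  erw [e]
  rw [h0]
  simp [hE, constantCoeff_subst_X_mul]

theorem existsUnique_mul_subst_eq_one (hE : constantCoeff E = 1) :
    ∃! G : K⟦X⟧, E * subst (X * E⁻¹) G = 1 := by
  have := existsUnique_fixed (fun G : K⟦X⟧ => G + (1 - E * subst (X * E⁻¹) G)) fun n f g h => by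
    have := coeff_mul_subst_sub hE h
    simp only [map_add, map_sub] at this ⊢
    linear_combination -this
  refine (existsUnique_congr fun G => ?_).1 this
  rw [add_eq_left, sub_eq_zero, eq_comm]

theorem constantCoeff_of_mul_subst_eq_one (hE : constantCoeff E = 1)
    (h : E * subst (X * E⁻¹) G = 1) : constantCoeff G = 1 := by
  have := congrArg constantCoeff h
  rwa [map_mul, constantCoeff_subst_X_mul, hE, one_mul, map_one] at this

/-- A left inverse is a right inverse: with `P = X / E` and `Q = X / G` the hypothesis says that
`Q(P) = X` and the conclusion that `P(Q) = X`. -/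
theorem mul_subst_eq_one_symm (hE : constantCoeff E = 1)
    (h : E * subst (X * E⁻¹) G = 1) : G * subst (X * G⁻¹) E = 1 := by
  have hG := constantCoeff_of_mul_subst_eq_one hE h
  have hs := hasSubst_X_mul E⁻¹
  have ht := hasSubst_X_mul G⁻¹
  have hEE := mul_inv_cancel_of_one hE
  have hGG := mul_inv_cancel_of_one hG
  have hQP : subst (X * E⁻¹) (X * G⁻¹) = (X : K⟦X⟧) := by
    rw [subst_mul hs, subst_X hs]
    have h1 : subst (X * E⁻¹) G * subst (X * E⁻¹) G⁻¹ = (1 : K⟦X⟧) := by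
      rw [← subst_mul hs, hGG, ← map_one (C (R := K)), subst_C]; rfl
    calc X * E⁻¹ * subst (X * E⁻¹) G⁻¹
        = X * E⁻¹ * subst (X * E⁻¹) G⁻¹ * (E * subst (X * E⁻¹) G) := by rw [h, mul_one]
      _ = X * (E * E⁻¹) * (subst (X * E⁻¹) G * subst (X * E⁻¹) G⁻¹) := by ring
      _ = X := by rw [h1, hEE]; ring
  have hP1 : IsUnit (coeff 1 (X * E⁻¹)) := by
    have := coeff_X_pow_mul E⁻¹ 1 0
    simp only [pow_one, zero_add] at this
    rw [this, coeff_zero_eq_constantCoeff_apply, constantCoeff_inv, hE, inv_one]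
    exact isUnit_one
  have hP0 : constantCoeff (X * E⁻¹) = 0 := by simp
  have hPQ : subst (X * G⁻¹) (X * E⁻¹) = (X : K⟦X⟧) := by
    have hS := HasSubst.substInvOfIsUnit (X * E⁻¹) hP1
    have hPS := subst_substInvOfIsUnit_right (X * E⁻¹) hP0 hP1
    have h1 := subst_comp_subst_apply hs hS (X * G⁻¹)
    rw [hQP, hPS, subst_X hS, X_subst] at h1
    rwa [h1] at hPS
  rw [subst_mul ht, subst_X ht] at hPQ
  have h2 : subst (X * G⁻¹) E * subst (X * G⁻¹) E⁻¹ = (1 : K⟦X⟧) := by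
    rw [← subst_mul ht, hEE, ← map_one (C (R := K)), subst_C]; rfl
  refine mul_left_cancel₀ (X_ne_zero (R := K)) ?_
  calc X * (G * subst (X * G⁻¹) E)
      = X * G⁻¹ * subst (X * G⁻¹) E⁻¹ * (G * subst (X * G⁻¹) E) := by rw [hPQ]
    _ = X * (G * G⁻¹) * (subst (X * G⁻¹) E * subst (X * G⁻¹) E⁻¹) := by ring
    _ = X * 1 := by rw [hGG, h2]; ring

end FormalInverse

section InverseBound

variable {K : Type*} [NormedField K] [IsUltrametricDist K] {E G : K⟦X⟧} {s q : ℝ}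

theorem GaussLe.pow_sub_one (hs : 0 ≤ s) (hq1 : q ≤ 1) (h : GaussLe s q (E - 1)) (k : ℕ) :
    GaussLe s q (E ^ k - 1) := by
  have hE : GaussLe s 1 E := by
    have := (h.mono hq1).add hs one
    rwa [sub_add_cancel] at this
  have := hE.pow_sub_pow hs one h k
  simpa using this

theorem GaussLe.inv_sub_one (hs : 0 ≤ s) (hq1 : q ≤ 1) (hE0 : constantCoeff E = 1)
    (h : GaussLe s q (E - 1)) : GaussLe s q (E⁻¹ - 1) := by
  have hEE := mul_inv_cancel_of_one hE0
  have hy0 : constantCoeff (E⁻¹ - 1) = 0 := by simp [hE0]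
  have hq0 := h.nonneg
  set y := E⁻¹ - 1 with hy
  have e : y = -(E - 1) - (E - 1) * y := by rw [hy]; linear_combination hEE
  intro n
  induction n using Nat.strong_induction_on with
  | _ n ih =>
    have h1 : coeff n ((E - 1) * y) = coeff n ((E - 1) * (PowerSeries.trunc n y : K⟦X⟧)) := by
      obtain ⟨r, hr⟩ := X_pow_dvd_sub_trunc n y
      have h2 : (E - 1) * y - (E - 1) * (PowerSeries.trunc n y : K⟦X⟧) = X ^ n * ((E - 1) * r) := by
        rw [← mul_sub, hr]; ring
      rw [← sub_eq_zero, ← map_sub, h2]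
      have := coeff_X_pow_mul ((E - 1) * r) n 0
      rw [zero_add] at this
      rw [this]
      simp [hE0]
    have h3 : GaussLe s q (-(E - 1) - (E - 1) * (PowerSeries.trunc n y : K⟦X⟧)) :=
      h.neg.sub hs ((h.mul hs (GaussLe.trunc hq0 ih)).mono (mul_le_of_le_one_left hq0 hq1))
    have := h3 n
    rwa [map_sub, ← h1, ← map_sub, ← e] at this

/-- The substitution `f ↦ E * f(X / E)` is close to the identity on series without constant
term. -/
theorem GaussLe.mul_subst_trunc_sub (hs : 0 ≤ s) (hq1 : q ≤ 1) (hE0 : constantCoeff E = 1)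
    (h : GaussLe s q (E - 1)) {M : ℝ} (hM : 0 ≤ M) {g : K⟦X⟧} (hg0 : constantCoeff g = 0) (n : ℕ)
    (hg : ∀ i < n, ‖coeff i g‖ * s ^ i ≤ M) :
    GaussLe s (M * q) (E * subst (X * E⁻¹) (PowerSeries.trunc n g : K⟦X⟧)
      - (PowerSeries.trunc n g : K⟦X⟧)) := by
  have hs' := hasSubst_X_mul E⁻¹
  have hEE := mul_inv_cancel_of_one hE0
  have hq0 := h.nonneg
  have ht : (PowerSeries.trunc n g : K⟦X⟧) = ∑ i ∈ Finset.range n, C (coeff i g) * X ^ i := by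
    ext k
    simp [coeff_trunc, coeff_X_pow]
  have hsub : subst (X * E⁻¹) (PowerSeries.trunc n g : K⟦X⟧)
      = ∑ i ∈ Finset.range n, C (coeff i g) * (X * E⁻¹) ^ i := by
    rw [ht, ← coe_substAlgHom hs', map_sum]
    refine Finset.sum_congr rfl fun i _ => ?_
    rw [coe_substAlgHom, subst_mul hs', subst_pow hs', subst_X hs', subst_C]
    rfl
  rw [hsub, ht, Finset.mul_sum, ← Finset.sum_sub_distrib]
  refine GaussLe.sum hs (by positivity) _ fun i hi => ?_
  obtain _ | i := i
  · simpa [hg0] using GaussLe.zero (by positivity)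
  have e : E * (C (coeff (i + 1) g) * (X * E⁻¹) ^ (i + 1)) - C (coeff (i + 1) g) * X ^ (i + 1)
      = (C (coeff (i + 1) g) * X ^ (i + 1)) * (E⁻¹ ^ i - 1) := by
    linear_combination (C (coeff (i + 1) g) * X ^ (i + 1) * E⁻¹ ^ i) * hEE
  rw [e]
  exact ((GaussLe.C_mul_X_pow hs _ _).mono (hg _ (Finset.mem_range.1 hi))).mul hs
    ((h.inv_sub_one hs hq1 hE0).pow_sub_one hs hq1 i)

/-- To first order, the inverse of `z * (1 + e(1 / z))` is `z * (1 - e(1 / z))`. -/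
theorem GaussLe.inverse (hs : 0 ≤ s) (hq1 : q ≤ 1) (hE0 : constantCoeff E = 1)
    (h : GaussLe s q (E - 1)) (hG : E * subst (X * E⁻¹) G = 1) :
    GaussLe s q (G - 1) ∧ GaussLe s (q * q) ((G - 1) + (E - 1)) := by
  have hs' := hasSubst_X_mul E⁻¹
  have hG0 := constantCoeff_of_mul_subst_eq_one hE0 hG
  have hq0 := h.nonneg
  set g := G - 1 with hg
  have hg0 : constantCoeff g = 0 := by simp [hg, hG0]
  have hEg : E * subst (X * E⁻¹) g = -(E - 1) := by
    have h1 : subst (X * E⁻¹) (1 : K⟦X⟧) = (1 : K⟦X⟧) := by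
      rw [← map_one (C (R := K)), subst_C]; rfl
    rw [hg, subst_sub hs']
    erw [h1]
    linear_combination hG
  have step (n : ℕ) (hn : ∀ i < n, ‖coeff i g‖ * s ^ i ≤ q) :
      ‖coeff n (g + (E - 1))‖ * s ^ n ≤ q * q := by
    have h1 := coeff_mul_subst_sub hE0 (X_pow_dvd_sub_trunc n g)
    have h2 := GaussLe.mul_subst_trunc_sub hs hq1 hE0 h hq0 hg0 n hn n
    have h3 : coeff n (g + (E - 1))
        = -coeff n (E * subst (X * E⁻¹) (PowerSeries.trunc n g : K⟦X⟧)
          - (PowerSeries.trunc n g : K⟦X⟧)) := by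
      rw [hEg] at h1
      simp only [map_sub, map_add, map_neg] at h1 ⊢
      linear_combination -h1
    rwa [h3, norm_neg]
  have hgq : GaussLe s q g := by
    intro n
    induction n using Nat.strong_induction_on with
    | _ n ih =>
      have h1 : coeff n g = coeff n (g + (E - 1)) - coeff n (E - 1) := by
        rw [map_add, add_sub_cancel_right]
      rw [h1, sub_eq_add_neg]
      refine (mul_le_mul_of_nonneg_right (IsUltrametricDist.norm_add_le_max _ _)
        (pow_nonneg hs n)).trans ?_
      rw [max_mul_of_nonneg _ _ (pow_nonneg hs n), norm_neg]
      exact max_le ((step n ih).trans (mul_le_of_le_one_left hq0 hq1)) (h n)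
  exact ⟨hgq, fun n => step n fun i _ => hgq i⟩

theorem norm_coeff_inverse_eq (hs : 0 < s) (hq0 : 0 < q) (hq1 : q < 1) (hE0 : constantCoeff E = 1)
    (h : GaussLe s q (E - 1)) (hG : E * subst (X * E⁻¹) G = 1) {n : ℕ} (hn : n ≠ 0)
    (hEn : ‖coeff n E‖ * s ^ n = q) : ‖coeff n G‖ * s ^ n = q := by
  have h1 := (GaussLe.inverse hs.le hq1.le hE0 h hG).2 n
  have h2 : coeff n (G - 1 + (E - 1)) = coeff n G + coeff n E := by
    simp [coeff_one, hn]
  rw [h2] at h1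
  have hsn := pow_pos hs n
  have hlt : ‖coeff n G + coeff n E‖ < ‖coeff n E‖ := by
    refine lt_of_mul_lt_mul_right ?_ hsn.le
    rw [hEn]
    exact h1.trans_lt (mul_lt_of_lt_one_left hq0 hq1)
  have h3 := IsUltrametricDist.norm_add_eq_max_of_norm_ne_norm (x := coeff n G + coeff n E)
    (y := -coeff n E) (by rw [norm_neg]; exact hlt.ne)
  rw [add_neg_cancel_right, norm_neg, max_eq_right hlt.le] at h3
  rw [h3, hEn]

end InverseBound

/-! ### Substitution into Laurent series -/

section Laurent

variable {K : Type*} [Field K] {E G : K⟦X⟧}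

theorem coeff_ofPowerSeries_of_neg (f : K⟦X⟧) {a : ℤ} (ha : a < 0) :
    (HahnSeries.ofPowerSeries ℤ K f).coeff a = 0 := by
  rw [HahnSeries.ofPowerSeries_apply]
  refine HahnSeries.embDomain_notin_image_support ?_
  rintro ⟨n, -, hn⟩
  have h : ((n : ℕ) : ℤ) = a := hn
  lia

/-- Evaluating a power series at a Laurent series which is itself a power series without constant
term amounts to substituting. -/
theorem heval_ofPowerSeries (E g : K⟦X⟧) (hg : constantCoeff g = 0) :
    heval (HahnSeries.ofPowerSeries ℤ K g) E = HahnSeries.ofPowerSeries ℤ K (subst g E) := by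
  have hs : HasSubst g := HasSubst.of_constantCoeff_zero' hg
  have hpos : 0 < (HahnSeries.ofPowerSeries ℤ K g).orderTop := by
    refine lt_of_lt_of_le (b := ((1 : ℤ) : WithTop ℤ)) (by norm_cast) ?_
    rw [HahnSeries.le_orderTop_iff_forall]
    intro j hj
    rcases lt_or_ge j 0 with h | h
    · exact coeff_ofPowerSeries_of_neg g h
    · have hj' : j < 1 := by exact_mod_cast hj
      obtain rfl : j = ((0 : ℕ) : ℤ) := by lia
      rw [HahnSeries.ofPowerSeries_apply_coeff, coeff_zero_eq_constantCoeff_apply, hg]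
  ext a
  rw [coeff_heval]
  have hfam (n : ℕ) : HahnSeries.SummableFamily.powerSeriesFamily
      (HahnSeries.ofPowerSeries ℤ K g) E n
        = coeff n E • HahnSeries.ofPowerSeries ℤ K (g ^ n) := by
    rw [HahnSeries.SummableFamily.powerSeriesFamily_of_orderTop_pos hpos, map_pow]
  change ∑ᶠ n, (HahnSeries.SummableFamily.powerSeriesFamily
    (HahnSeries.ofPowerSeries ℤ K g) E n).coeff a = _
  simp only [hfam]
  by_cases ha : 0 ≤ a
  · obtain ⟨m, rfl⟩ := Int.eq_ofNat_of_zero_le ha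
    have h (f : K⟦X⟧) : (HahnSeries.ofPowerSeries ℤ K f).coeff (m : ℤ) = coeff m f :=
      HahnSeries.ofPowerSeries_apply_coeff f m
    rw [h, coeff_subst' hs]
    refine finsum_congr fun n => ?_
    rw [HahnSeries.coeff_smul, h]
  · have ha' : a < 0 := not_le.1 ha
    rw [coeff_ofPowerSeries_of_neg _ ha']
    refine finsum_eq_zero_of_forall_eq_zero fun n => ?_
    rw [HahnSeries.coeff_smul, coeff_ofPowerSeries_of_neg _ ha', smul_zero]

theorem z_ne_zero : z K ≠ 0 := HahnSeries.single_ne_zero one_ne_zero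

theorem z_mul_X : z K * HahnSeries.ofPowerSeries ℤ K X = 1 := by
  rw [HahnSeries.ofPowerSeries_X, z, HahnSeries.single_mul_single, mul_one]
  rfl

theorem formalEval_z_mul (E U : K⟦X⟧) (hU : constantCoeff U = 1) :
    formalEval E (z K * HahnSeries.ofPowerSeries ℤ K U)
      = z K * HahnSeries.ofPowerSeries ℤ K (U * subst (X * U⁻¹) E) := by
  have hinv : (z K * HahnSeries.ofPowerSeries ℤ K U)⁻¹
      = HahnSeries.ofPowerSeries ℤ K (X * U⁻¹) := by
    refine inv_eq_of_mul_eq_one_right ?_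
    rw [map_mul, mul_mul_mul_comm, z_mul_X, ← map_mul, mul_inv_cancel_of_one hU, map_one, one_mul]
  rw [formalEval, hinv, heval_ofPowerSeries _ _ (by simp), map_mul, mul_assoc]

theorem formalEval_z (E : K⟦X⟧) :
    formalEval E (z K) = z K * HahnSeries.ofPowerSeries ℤ K E := by
  have := formalEval_z_mul E 1 (map_one _)
  have h1 : (1 : K⟦X⟧)⁻¹ = 1 := by
    rw [PowerSeries.inv_eq_iff_mul_eq_one (by simp), mul_one]
  rwa [map_one, mul_one, h1, mul_one, X_subst, one_mul] at this

theorem formalEval_z_pow {d : ℕ} (hd : d ≠ 0) (E : K⟦X⟧) :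
    formalEval E (z K ^ d) = z K ^ d * HahnSeries.ofPowerSeries ℤ K (expand d hd E) := by
  have hinv : (z K ^ d)⁻¹ = HahnSeries.ofPowerSeries ℤ K (X ^ d) := by
    refine inv_eq_of_mul_eq_one_right ?_
    rw [map_pow, ← mul_pow, z_mul_X, one_pow]
  rw [formalEval, hinv, heval_ofPowerSeries _ _ (by simp [hd]), expand_apply]

theorem ofPowerSeries_injective : Function.Injective (HahnSeries.ofPowerSeries ℤ K) :=
  HahnSeries.ofPowerSeries_injective

/-- In terms of the power series `E` encoding `φ`, the equation `φ(z) ^ d - c = φ(z ^ d)` reads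
`E ^ d - c X ^ d = E(X ^ d)`. -/
theorem functional_eq_iff {d : ℕ} (hd : d ≠ 0) (c : K) :
    formalEval E (z K) ^ d - HahnSeries.C c = formalEval E (z K ^ d) ↔
      E ^ d = expand d hd E + C c * X ^ d := by
  have hC : (HahnSeries.C c : LaurentSeries K)
      = z K ^ d * HahnSeries.ofPowerSeries ℤ K (C c * X ^ d) := by
    rw [map_mul, map_pow, mul_left_comm, ← mul_pow, z_mul_X, one_pow, mul_one,
      HahnSeries.ofPowerSeries_C]
  rw [formalEval_z, formalEval_z_pow hd, hC, mul_pow, ← map_pow, ← mul_sub, ← map_sub,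
    mul_right_inj' (pow_ne_zero d z_ne_zero), ofPowerSeries_injective.eq_iff, sub_eq_iff_eq_add]

theorem isFormalInverse_iff (hE : constantCoeff E = 1) :
    IsFormalInverse E G ↔ E * subst (X * E⁻¹) G = 1 := by
  have key (U V : K⟦X⟧) (hU : constantCoeff U = 1) :
      formalEval V (formalEval U (z K)) = z K ↔ U * subst (X * U⁻¹) V = 1 := by
    rw [formalEval_z, formalEval_z_mul V U hU, mul_eq_left₀ z_ne_zero,
      ← map_one (HahnSeries.ofPowerSeries ℤ K), ofPowerSeries_injective.eq_iff]
  refine ⟨fun h => (key E G hE).1 h.left_inv, fun h => ?_⟩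
  have hG := constantCoeff_of_mul_subst_eq_one hE h
  exact ⟨by simpa using hG, (key G E hG).2 (mul_subst_eq_one_symm hE h), (key E G hE).2 h⟩

/-- A series `φ(z) = z * (1 + ∑ aₙ / z ^ (n d))` is `z * A(1 / z ^ d)` with `A = 1 + v`, and its
functional equation reads `A ^ d = A(X ^ d) + c X`. -/
theorem isInverseBottcher_iff {d : ℕ} (hd : d ≠ 0) (c : K) :
    IsInverseBottcher d c E ↔ ∃ v : K⟦X⟧, E = expand d hd (1 + v) ∧ constantCoeff v = 0 ∧
      (1 + v) ^ d = 1 + (expand d hd v + C c * X) := by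
  have hinj (f g : K⟦X⟧) : expand d hd f = expand d hd g ↔ f = g := by
    refine ⟨fun h => ?_, fun h => h ▸ rfl⟩
    ext n
    rw [← coeff_expand_mul d hd, h, coeff_expand_mul]
  have heq (v : K⟦X⟧) : expand d hd (1 + v) ^ d
      = expand d hd (expand d hd (1 + v)) + C c * X ^ d ↔
        (1 + v) ^ d = 1 + (expand d hd v + C c * X) := by
    have h1 : expand d hd (expand d hd (1 + v)) + C c * X ^ d
        = expand d hd (1 + (expand d hd v + C c * X)) := by
      simp only [map_add, map_one, map_mul, expand_C, expand_X]
      ring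
    rw [h1, ← map_pow, hinj]
  constructor
  · rintro ⟨h0, hdvd, hfe⟩
    have hE : E = expand d hd (1 + ((PowerSeries.mk fun n => coeff (d * n) E) - 1)) := by
      ext n
      rw [add_sub_cancel, coeff_expand]
      split_ifs with h
      · obtain ⟨m, rfl⟩ := h
        rw [coeff_mk, Nat.mul_div_cancel_left _ (Nat.pos_of_ne_zero hd)]
      · exact hdvd n h
    refine ⟨_, hE, ?_, ?_⟩
    · rw [← coeff_zero_eq_constantCoeff_apply, map_sub, coeff_mk, mul_zero, h0]; simp
    · rw [functional_eq_iff hd] at hfe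
      rw [← heq, ← hE, hfe]
  · rintro ⟨v, rfl, hv0, hv⟩
    refine ⟨?_, fun m hm => coeff_expand_of_not_dvd d hd _ hm, ?_⟩
    · simp [hv0]
    · rw [functional_eq_iff hd, heq, hv]

theorem existsUnique_isInverseBottcher {d : ℕ} (hd : 2 ≤ d) (hdK : (d : K) ≠ 0) (c : K) :
    ∃! E : K⟦X⟧, IsInverseBottcher d c E := by
  have hd0 : d ≠ 0 := by lia
  -- One Newton step for the functional equation, with the constant term of `f` removed so that the
  -- constant term of `T f` is `0` for every `f`.
  let T : K⟦X⟧ → K⟦X⟧ := fun f => f - C (constantCoeff f)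
      - C (d : K)⁻¹ * ((1 + (f - C (constantCoeff f))) ^ d
        - (1 + (expand d hd0 (f - C (constantCoeff f)) + C c * X)))
  have hT0 (f : K⟦X⟧) : constantCoeff (T f) = 0 := by simp [T]
  have hT : ∃! v, T v = v := by
    refine existsUnique_fixed _ fun n f g h => ?_
    rcases Nat.eq_zero_or_pos n with rfl | hn
    · rw [coeff_zero_eq_constantCoeff_apply, coeff_zero_eq_constantCoeff_apply, hT0, hT0]
    have hlow := X_pow_dvd_iff.1 h
    have hfg : constantCoeff f = constantCoeff g := by
      have := hlow 0 hn
      rwa [coeff_zero_eq_constantCoeff_apply, map_sub, sub_eq_zero] at this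
    have h1 := coeff_one_add_pow_sub d n (v := f - C (constantCoeff f))
      (w := g - C (constantCoeff g)) (by simp) (by simp)
      (by rwa [hfg, sub_sub_sub_cancel_right])
    have h2 : coeff n (expand d hd0 (f - g)) = 0 := by
      rw [coeff_expand]
      split_ifs with hdn
      · exact hlow _ (Nat.div_lt_self hn (by lia))
      · rfl
    simp only [map_sub, hfg, sub_sub_sub_cancel_right] at h1 h2
    simp only [T, map_sub, map_add, coeff_C_mul, hfg, expand_C] at h1 h2 ⊢
    have h3 : (d : K)⁻¹ * (d * (coeff n f - coeff n g)) = coeff n f - coeff n g :=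
      inv_mul_cancel_left₀ hdK _
    linear_combination -(d : K)⁻¹ * h1 + (d : K)⁻¹ * h2 - h3
  have key (v : K⟦X⟧) : T v = v ↔
      constantCoeff v = 0 ∧ (1 + v) ^ d = 1 + (expand d hd0 v + C c * X) := by
    have hCd : C (d : K)⁻¹ ≠ (0 : K⟦X⟧) := by simpa using hdK
    have h (hv : constantCoeff v = 0) :
        T v = v ↔ (1 + v) ^ d = 1 + (expand d hd0 v + C c * X) := by
      simp only [T, hv, map_zero, sub_zero]
      rw [sub_eq_self, mul_eq_zero, or_iff_right hCd, sub_eq_zero]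
    refine ⟨fun hv => ?_, fun hv => (h hv.1).2 hv.2⟩
    have h0 : constantCoeff v = 0 := hv ▸ hT0 v
    exact ⟨h0, (h h0).1 hv⟩
  obtain ⟨v, hv, huniq⟩ := hT
  refine ⟨expand d hd0 (1 + v), (isInverseBottcher_iff hd0 c).2 ⟨v, rfl, (key v).1 hv⟩, ?_⟩
  intro E hE
  obtain ⟨w, rfl, hw⟩ := (isInverseBottcher_iff hd0 c).1 hE
  rw [huniq w ((key w).2 hw)]

end Laurent

/-! ### Convergence and values of series at infinity -/

section Value

open Filter Topology

variable {p : ℕ} [Fact p.Prime] {E : ℂ_[p]⟦X⟧} {s q : ℝ}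

theorem norm_zpow_one_sub {x : ℂ_[p]} (hx : x ≠ 0) (n : ℕ) :
    ‖x ^ (1 - (n : ℤ))‖ = ‖x‖ * ‖x‖⁻¹ ^ n := by
  rw [norm_zpow, zpow_sub₀ (norm_ne_zero_iff.2 hx), zpow_one, zpow_natCast, inv_pow, div_eq_mul_inv]

theorem ne_zero_of_mem_diskAtInfinity (hs : 0 < s) {x : ℂ_[p]} (hx : x ∈ diskAtInfinity p s⁻¹) :
    x ≠ 0 :=
  norm_pos_iff.1 ((inv_pos.2 hs).trans hx)

theorem norm_inv_lt_of_mem_diskAtInfinity (hs : 0 < s) {x : ℂ_[p]}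
    (hx : x ∈ diskAtInfinity p s⁻¹) : ‖x‖⁻¹ < s :=
  (inv_lt_comm₀ hs ((inv_pos.2 hs).trans hx)).1 hx

theorem convergesAt_of_gaussLe (hs : 0 < s) {M : ℝ} (hE : GaussLe s M E) {x : ℂ_[p]}
    (hx : x ∈ diskAtInfinity p s⁻¹) : ConvergesAt E x := by
  have hx0 := ne_zero_of_mem_diskAtInfinity hs hx
  have hlt := norm_inv_lt_of_mem_diskAtInfinity hs hx
  refine NonarchimedeanAddGroup.summable_of_tendsto_cofinite_zero ?_
  rw [Nat.cofinite_eq_atTop]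
  have hr : ‖x‖⁻¹ / s < 1 := (div_lt_one hs).2 hlt
  have h1 : Tendsto (fun n : ℕ => M * ‖x‖ * (‖x‖⁻¹ / s) ^ n) atTop (𝓝 0) := by
    simpa using (tendsto_pow_atTop_nhds_zero_of_lt_one (by positivity) hr).const_mul (M * ‖x‖)
  refine squeeze_zero_norm (fun n => ?_) h1
  rw [norm_mul, norm_zpow_one_sub hx0]
  have : ‖x‖⁻¹ ^ n = s ^ n * (‖x‖⁻¹ / s) ^ n := by rw [← mul_pow, mul_div_cancel₀ _ hs.ne']
  rw [this]
  calc ‖coeff n E‖ * (‖x‖ * (s ^ n * (‖x‖⁻¹ / s) ^ n))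
      = (‖coeff n E‖ * s ^ n) * (‖x‖ * (‖x‖⁻¹ / s) ^ n) := by ring
    _ ≤ M * (‖x‖ * (‖x‖⁻¹ / s) ^ n) := mul_le_mul_of_nonneg_right (hE n) (by positivity)
    _ = _ := by ring

theorem not_convergesAt (hs : 0 < s) (hq : 0 < q)
    (hfreq : ∃ᶠ n in atTop, ‖coeff n E‖ * s ^ n = q) {x : ℂ_[p]} (hx : ‖x‖ = s⁻¹) :
    ¬ ConvergesAt E x := by
  intro h
  have hx0 : x ≠ 0 := norm_pos_iff.1 (by rw [hx]; positivity)
  have ht := (Summable.tendsto_atTop_zero h).norm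
  rw [norm_zero] at ht
  have hev := ht.eventually (gt_mem_nhds (show 0 < q * s⁻¹ by positivity))
  obtain ⟨n, hn, hn'⟩ := (hfreq.and_eventually hev).exists
  rw [norm_mul, norm_zpow_one_sub hx0, hx, inv_inv, mul_left_comm, hn, mul_comm] at hn'
  exact lt_irrefl _ hn'

/-- The series diverges at the points of the boundary circle, such as `x₀`, so that it converges on
no larger disk. -/
theorem isMaximalConvergentDisk (hs : 0 < s) (hq : 0 < q) {M : ℝ} (hE : GaussLe s M E)
    (hfreq : ∃ᶠ n in atTop, ‖coeff n E‖ * s ^ n = q) {x₀ : ℂ_[p]} (hx₀ : ‖x₀‖ = s⁻¹) :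
    IsMaximalConvergentDisk E (diskAtInfinity p s⁻¹) := by
  refine ⟨⟨s⁻¹, (inv_pos.2 hs).le, rfl, fun x hx => convergesAt_of_gaussLe hs hE hx⟩, ?_⟩
  rintro U ⟨r, -, rfl, hU⟩ x hx
  have hr : s⁻¹ ≤ r := by
    by_contra! h
    exact not_convergesAt hs hq hfreq hx₀ (hU x₀ (show r < ‖x₀‖ by rwa [hx₀]))
  exact hr.trans_lt hx

/-- The case `n = 1` is trivial, and for `n ≥ 2` the difference of powers of `x⁻¹` and `y⁻¹` factors
through `x⁻¹ - y⁻¹ = (y - x) / (x y)`. -/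
theorem norm_zpow_sub_zpow_le (hs : 0 < s) {x y : ℂ_[p]} (hx : x ∈ diskAtInfinity p s⁻¹)
    (hy : y ∈ diskAtInfinity p s⁻¹) (n : ℕ) :
    ‖x ^ (1 - (n : ℤ)) - y ^ (1 - (n : ℤ))‖ ≤ ‖x - y‖ * s ^ n := by
  have hx0 := ne_zero_of_mem_diskAtInfinity hs hx
  have hy0 := ne_zero_of_mem_diskAtInfinity hs hy
  have hxs := norm_inv_lt_of_mem_diskAtInfinity hs hx
  have hys := norm_inv_lt_of_mem_diskAtInfinity hs hy
  obtain _ | _ | n := n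
  · simp
  · simp [mul_nonneg, hs.le]
  have e (z : ℂ_[p]) : z ^ (1 - ((n + 1 + 1 : ℕ) : ℤ)) = z⁻¹ ^ (n + 1) := by
    rw [inv_pow, ← zpow_natCast, ← zpow_neg]; congr 1
  rw [e, e, ← geom_sum₂_mul, norm_mul]
  have h1 : ‖x⁻¹ - y⁻¹‖ ≤ ‖x - y‖ * (s * s) := by
    rw [inv_sub_inv hx0 hy0, norm_div, norm_mul, norm_sub_rev y x, div_eq_mul_inv, mul_inv]
    gcongr
  have h2 : ‖∑ i ∈ Finset.range (n + 1), x⁻¹ ^ i * y⁻¹ ^ (n + 1 - 1 - i)‖ ≤ s ^ n := by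
    refine IsUltrametricDist.norm_sum_le_of_forall_le_of_nonneg (by positivity) fun i hi => ?_
    have : n = i + (n + 1 - 1 - i) := by have := Finset.mem_range.1 hi; lia
    rw [norm_mul, norm_pow, norm_pow, norm_inv, norm_inv]
    calc ‖x‖⁻¹ ^ i * ‖y‖⁻¹ ^ (n + 1 - 1 - i) ≤ s ^ i * s ^ (n + 1 - 1 - i) := by gcongr
      _ = s ^ n := by rw [← pow_add, ← this]
  calc _ ≤ s ^ n * (‖x - y‖ * (s * s)) := mul_le_mul h2 h1 (norm_nonneg _) (by positivity)
    _ = _ := by ring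

theorem value_eq_add (hs : 0 < s) (hE : GaussLe s q (E - 1)) {x : ℂ_[p]}
    (hx : x ∈ diskAtInfinity p s⁻¹) : value E x = x + value (E - 1) x := by
  have h1 : HasSum (fun n : ℕ => coeff n (1 : ℂ_[p]⟦X⟧) * x ^ (1 - (n : ℤ))) x := by
    have := hasSum_single (f := fun n : ℕ => coeff n (1 : ℂ_[p]⟦X⟧) * x ^ (1 - (n : ℤ))) 0
      (fun n hn => by simp [coeff_one, hn])
    simpa using this
  have h2 := (convergesAt_of_gaussLe hs hE hx).hasSum
  rw [value]
  refine Eq.trans (congrArg tsum (funext fun n => ?_)) (h1.add h2).tsum_eq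
  rw [← add_mul, ← map_add, add_sub_cancel]

theorem norm_value_sub_value_le (hs : 0 < s) (hE : GaussLe s q E) {x y : ℂ_[p]}
    (hx : x ∈ diskAtInfinity p s⁻¹) (hy : y ∈ diskAtInfinity p s⁻¹) :
    ‖value E x - value E y‖ ≤ q * ‖x - y‖ := by
  rw [value, value, ← (convergesAt_of_gaussLe hs hE hx).tsum_sub (convergesAt_of_gaussLe hs hE hy)]
  refine IsUltrametricDist.norm_tsum_le_of_forall_le_of_nonneg
    (mul_nonneg hE.nonneg (norm_nonneg _)) fun n => ?_
  rw [← mul_sub, norm_mul]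
  calc _ ≤ ‖coeff n E‖ * (‖x - y‖ * s ^ n) :=
        mul_le_mul_of_nonneg_left (norm_zpow_sub_zpow_le hs hx hy n) (norm_nonneg _)
    _ = (‖coeff n E‖ * s ^ n) * ‖x - y‖ := by ring
    _ ≤ _ := mul_le_mul_of_nonneg_right (hE n) (norm_nonneg _)

theorem norm_value_le (hs : 0 < s) (hE : GaussLe s q E) {x : ℂ_[p]}
    (hx : x ∈ diskAtInfinity p s⁻¹) : ‖value E x‖ ≤ q * ‖x‖ := by
  refine IsUltrametricDist.norm_tsum_le_of_forall_le_of_nonneg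
    (mul_nonneg hE.nonneg (norm_nonneg _)) fun n => ?_
  rw [norm_mul, norm_zpow_one_sub (ne_zero_of_mem_diskAtInfinity hs hx)]
  have := norm_inv_lt_of_mem_diskAtInfinity hs hx
  calc _ ≤ ‖coeff n E‖ * (‖x‖ * s ^ n) := by gcongr
    _ = (‖coeff n E‖ * s ^ n) * ‖x‖ := by ring
    _ ≤ _ := mul_le_mul_of_nonneg_right (hE n) (norm_nonneg _)

theorem norm_value_sub_value (hs : 0 < s) (hq1 : q < 1) (hE : GaussLe s q (E - 1)) {x y : ℂ_[p]}
    (hx : x ∈ diskAtInfinity p s⁻¹) (hy : y ∈ diskAtInfinity p s⁻¹) :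
    ‖value E x - value E y‖ = ‖x - y‖ := by
  rcases eq_or_ne x y with rfl | hxy
  · simp
  have hpos : 0 < ‖x - y‖ := norm_pos_iff.2 (sub_ne_zero.2 hxy)
  have hlt : ‖value (E - 1) x - value (E - 1) y‖ < ‖x - y‖ :=
    (norm_value_sub_value_le hs hE hx hy).trans_lt (mul_lt_of_lt_one_left hpos hq1)
  rw [value_eq_add hs hE hx, value_eq_add hs hE hy, add_sub_add_comm,
    IsUltrametricDist.norm_add_eq_max_of_norm_ne_norm hlt.ne', max_eq_left hlt.le]

theorem norm_value (hs : 0 < s) (hq1 : q < 1) (hE : GaussLe s q (E - 1)) {x : ℂ_[p]}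
    (hx : x ∈ diskAtInfinity p s⁻¹) : ‖value E x‖ = ‖x‖ := by
  have hpos : 0 < ‖x‖ := norm_pos_iff.2 (ne_zero_of_mem_diskAtInfinity hs hx)
  have hlt : ‖value (E - 1) x‖ < ‖x‖ :=
    (norm_value_le hs hE hx).trans_lt (mul_lt_of_lt_one_left hpos hq1)
  rw [value_eq_add hs hE hx, IsUltrametricDist.norm_add_eq_max_of_norm_ne_norm hlt.ne',
    max_eq_left hlt.le]

/-- Surjectivity comes from the contraction `x ↦ y - (φ(x) - x)` of the sphere `‖x‖ = ‖y‖`. -/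
theorem bijOn_value (hs : 0 < s) (hq1 : q < 1) (hE : GaussLe s q (E - 1)) :
    Set.BijOn (value E) (diskAtInfinity p s⁻¹) (diskAtInfinity p s⁻¹) := by
  refine ⟨fun x hx => ?_, fun x hx y hy hxy => ?_, fun y hy => ?_⟩
  · rw [diskAtInfinity, Set.mem_ofPred_eq, norm_value hs hq1 hE hx]; exact hx
  · have := norm_value_sub_value hs hq1 hE hx hy
    rw [hxy, sub_self, norm_zero] at this
    exact sub_eq_zero.1 (norm_eq_zero.1 this.symm)
  · have hS : Metric.sphere (0 : ℂ_[p]) ‖y‖ ⊆ diskAtInfinity p s⁻¹ := fun x hx => by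
      rw [mem_sphere_zero_iff_norm] at hx
      rw [diskAtInfinity, Set.mem_ofPred_eq, hx]; exact hy
    have hypos : 0 < ‖y‖ := norm_pos_iff.2 (ne_zero_of_mem_diskAtInfinity hs hy)
    let F : ℂ_[p] → ℂ_[p] := fun x => y - value (E - 1) x
    have hmaps : Set.MapsTo F (Metric.sphere 0 ‖y‖) (Metric.sphere 0 ‖y‖) := fun x hx => by
      have h1 := norm_value_le hs hE (hS hx)
      rw [mem_sphere_zero_iff_norm] at hx ⊢
      rw [hx] at h1
      have hlt : ‖-value (E - 1) x‖ < ‖y‖ := by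
        rw [norm_neg]; exact h1.trans_lt (mul_lt_of_lt_one_left hypos hq1)
      change ‖y - value (E - 1) x‖ = ‖y‖
      rw [sub_eq_add_neg, IsUltrametricDist.norm_add_eq_max_of_norm_ne_norm hlt.ne',
        max_eq_left hlt.le]
    have hcontr : ContractingWith ⟨q, hE.nonneg⟩ (hmaps.restrict F _ _) := by
      refine ⟨by exact_mod_cast hq1, LipschitzWith.of_dist_le_mul fun a b => ?_⟩
      have := norm_value_sub_value_le hs hE (hS a.2) (hS b.2)
      rw [Subtype.dist_eq, Subtype.dist_eq, dist_eq_norm, dist_eq_norm]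
      simp only [Set.MapsTo.val_restrict_apply, F, sub_sub_sub_cancel_left]
      rw [norm_sub_rev]
      exact this
    obtain ⟨x, hx, hfix, -⟩ := hcontr.exists_fixedPoint' Metric.isClosed_sphere.isComplete hmaps
      (mem_sphere_zero_iff_norm.2 rfl) (edist_ne_top y (F y))
    refine ⟨x, hS hx, ?_⟩
    have hfix' : y - value (E - 1) x = x := hfix
    rw [value_eq_add hs hE (hS hx)]
    exact (sub_eq_iff_eq_add.1 hfix').symm

end Value

/-! ### The critical radius -/

/-- If `C * R ^ (d ^ j)` meets `q * e ^ (j + 1)` at `j = N`, then the ratio of the two, which is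
multiplied by `(R ^ (d ^ j)) ^ (d - 1) / e` from `j` to `j + 1`, has a strict maximum there as soon
as this factor is less than `1` at `j = N` and more than `1` at `j = N - 1`. -/
theorem exists_peak {d N : ℕ} (hd : 2 ≤ d) {C R q e : ℝ} (hC : 0 < C) (hR : 0 < R) (hq : 0 < q)
    (he : 0 < e) (he1 : e < 1) (hN : C * R ^ d ^ N = q * e ^ (N + 1))
    (h1 : (R ^ d ^ N) ^ (d - 1) < e) (h2 : ∀ i, i + 1 = N → e < (R ^ d ^ i) ^ (d - 1)) :
    ∃ δ < 1, e ≤ δ ∧ ∀ j, j ≠ N → C * R ^ d ^ j ≤ δ * (q * e ^ (j + 1)) := by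
  have hR1 : R < 1 := by
    by_contra! h
    have : 1 ≤ (R ^ d ^ N) ^ (d - 1) := one_le_pow₀ (one_le_pow₀ h)
    linarith
  obtain ⟨δ, hδ1, heδ, hδ2, hδ3⟩ : ∃ δ < 1, e ≤ δ ∧ (R ^ d ^ N) ^ (d - 1) ≤ δ * e ∧
      ∀ i, i + 1 = N → e ≤ δ * (R ^ d ^ i) ^ (d - 1) := by
    have hk1 : (R ^ d ^ N) ^ (d - 1) / e < 1 := (div_lt_one he).2 h1
    obtain _ | N := N
    · refine ⟨max e ((R ^ d ^ 0) ^ (d - 1) / e), max_lt he1 hk1, le_max_left _ _, ?_,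
        fun i hi => by lia⟩
      rw [← div_le_iff₀ he]; exact le_max_right _ _
    · have hpos : 0 < (R ^ d ^ N) ^ (d - 1) := by positivity
      have hk2 : e / (R ^ d ^ N) ^ (d - 1) < 1 := (div_lt_one hpos).2 (h2 N rfl)
      refine ⟨max e (max ((R ^ d ^ (N + 1)) ^ (d - 1) / e) (e / (R ^ d ^ N) ^ (d - 1))),
        max_lt he1 (max_lt hk1 hk2), le_max_left _ _, ?_, fun i hi => ?_⟩
      · rw [← div_le_iff₀ he]
        exact (le_max_left _ _).trans (le_max_right _ _)
      · obtain rfl : i = N := by lia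
        rw [← div_le_iff₀ hpos]
        exact (le_max_right _ _).trans (le_max_right _ _)
  have hδ0 : 0 < δ := he.trans_le heδ
  have hsucc (j : ℕ) : R ^ d ^ (j + 1) = R ^ d ^ j * (R ^ d ^ j) ^ (d - 1) := by
    rw [← pow_succ', Nat.sub_add_cancel (by lia), ← pow_mul, ← pow_succ]
  have hanti {i j : ℕ} (hij : i ≤ j) : (R ^ d ^ j) ^ (d - 1) ≤ (R ^ d ^ i) ^ (d - 1) :=
    pow_le_pow_left₀ (by positivity)
      (pow_le_pow_of_le_one hR.le hR1.le (Nat.pow_le_pow_right (by lia) hij)) _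
  have hmul {j : ℕ} : δ * (q * e ^ (j + 1)) ≤ q * e ^ (j + 1) :=
    mul_le_of_le_one_left (by positivity) hδ1.le
  have up (i : ℕ) : C * R ^ d ^ (N + i + 1) ≤ δ * (q * e ^ (N + i + 2)) := by
    have hle : C * R ^ d ^ (N + i) ≤ q * e ^ (N + i + 1) := by
      induction i with
      | zero => exact hN.le
      | succ i ih =>
        refine le_trans ?_ (hmul (j := N + (i + 1)))
        calc C * R ^ d ^ (N + i + 1) = (C * R ^ d ^ (N + i)) * (R ^ d ^ (N + i)) ^ (d - 1) := by
              rw [hsucc]; ring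
          _ ≤ (q * e ^ (N + i + 1)) * (δ * e) :=
              mul_le_mul ih ((hanti (by lia)).trans hδ2) (by positivity) (by positivity)
          _ = δ * (q * e ^ (N + (i + 1) + 1)) := by ring
    calc C * R ^ d ^ (N + i + 1) = (C * R ^ d ^ (N + i)) * (R ^ d ^ (N + i)) ^ (d - 1) := by
          rw [hsucc]; ring
      _ ≤ (q * e ^ (N + i + 1)) * (δ * e) :=
          mul_le_mul hle ((hanti (by lia)).trans hδ2) (by positivity) (by positivity)
      _ = δ * (q * e ^ (N + i + 2)) := by ring
  have down (i : ℕ) : ∀ j, j + i + 1 = N → C * R ^ d ^ j ≤ δ * (q * e ^ (j + 1)) := by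
    have step (j : ℕ) (hj : j + 1 ≤ N) (h : C * R ^ d ^ (j + 1) ≤ q * e ^ (j + 2)) :
        C * R ^ d ^ j ≤ δ * (q * e ^ (j + 1)) := by
      obtain ⟨k, rfl⟩ : ∃ k, N = k + 1 := ⟨N - 1, by lia⟩
      refine le_of_mul_le_mul_right ?_ he
      have h3 : e ≤ δ * (R ^ d ^ j) ^ (d - 1) :=
        (hδ3 k rfl).trans (mul_le_mul_of_nonneg_left (hanti (by lia)) hδ0.le)
      calc C * R ^ d ^ j * e ≤ C * R ^ d ^ j * (δ * (R ^ d ^ j) ^ (d - 1)) :=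
            mul_le_mul_of_nonneg_left h3 (by positivity)
        _ = δ * (C * R ^ d ^ (j + 1)) := by rw [hsucc]; ring
        _ ≤ δ * (q * e ^ (j + 2)) := mul_le_mul_of_nonneg_left h hδ0.le
        _ = _ := by ring
    induction i with
    | zero =>
      rintro j rfl
      exact step j le_rfl hN.le
    | succ i ih =>
      intro j hj
      exact step j (by lia) ((ih (j + 1) (by lia)).trans hmul)
  refine ⟨δ, hδ1, heδ, fun j hj => ?_⟩
  rcases lt_or_gt_of_ne hj with h | h
  · exact down (N - j - 1) j (by lia)
  · obtain ⟨i, rfl⟩ : ∃ i, j = N + i + 1 := ⟨j - N - 1, by lia⟩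
    exact up i

section Conditions

variable {p : ℕ} [Fact p.Prime] {N d : ℕ} {c : ℂ_[p]}

theorem vp_of_ne_zero (hc : c ≠ 0) : vp p c = ((-Real.logb p ‖c‖ : ℝ) : EReal) := by
  rw [vp, if_neg hc]

theorem ne_zero_of_vp_lt {a : ℝ} (h : vp p c < (a : EReal)) : c ≠ 0 := by
  rintro rfl
  rw [vp, if_pos rfl] at h
  exact not_top_lt h

theorem vp_lt_iff (hc : c ≠ 0) (a : ℝ) : vp p c < (a : EReal) ↔ (p : ℝ) ^ (-a) < ‖c‖ := by
  have h1 := one_lt_natCast_prime p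
  rw [vp_of_ne_zero hc, EReal.coe_lt_coe_iff, neg_lt,
    Real.lt_logb_iff_rpow_lt h1 (norm_pos_iff.2 hc)]

theorem lt_vp_iff (hc : c ≠ 0) (a : ℝ) : (a : EReal) < vp p c ↔ ‖c‖ < (p : ℝ) ^ (-a) := by
  have h1 := one_lt_natCast_prime p
  rw [vp_of_ne_zero hc, EReal.coe_lt_coe_iff, lt_neg,
    Real.logb_lt_iff_lt_rpow h1 (norm_pos_iff.2 hc)]

/-- The number `p ^ (-(k v_p(d) + v_p((d - 1)!) / (d - 1)))` of the two conditions, raised to the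
power `d - 1`. -/
theorem rpow_threshold_pow (hd : 2 ≤ d) (k : ℕ) :
    ((p : ℝ) ^ (-((k : ℝ) * (padicValNat p d : ℝ)
      + (padicValNat p (d - 1).factorial : ℝ) / ((d : ℝ) - 1)))) ^ (d - 1)
      = (‖(d : ℂ_[p])‖ ^ k) ^ (d - 1) * ‖((d - 1).factorial : ℂ_[p])‖ := by
  have h1 := one_lt_natCast_prime p
  have hp0 : (0 : ℝ) < p := by linarith
  have hd1 : ((d - 1 : ℕ) : ℝ) = d - 1 := by rw [Nat.cast_sub (by lia), Nat.cast_one]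
  have hd2 : (d : ℝ) - 1 ≠ 0 := by rw [← hd1]; exact_mod_cast (by lia : d - 1 ≠ 0)
  rw [norm_natCast_eq p (by lia : d ≠ 0), norm_natCast_eq p (d - 1).factorial_ne_zero,
    ← Real.rpow_natCast, ← Real.rpow_natCast, ← Real.rpow_natCast, ← Real.rpow_mul hp0.le,
    ← Real.rpow_mul hp0.le, ← Real.rpow_mul hp0.le, ← Real.rpow_add hp0, hd1]
  congr 1
  field_simp
  ring

theorem vp_lt_threshold (hd : 2 ≤ d) (hc : c ≠ 0) (k : ℕ)
    (h : vp p c < (((k : ℝ) * (padicValNat p d : ℝ)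
      + (padicValNat p (d - 1).factorial : ℝ) / ((d : ℝ) - 1) : ℝ) : EReal)) :
    (‖(d : ℂ_[p])‖ ^ k) ^ (d - 1) * ‖((d - 1).factorial : ℂ_[p])‖ < ‖c‖ ^ (d - 1) := by
  rw [← rpow_threshold_pow hd]
  exact pow_lt_pow_left₀ ((vp_lt_iff hc _).1 h)
    (Real.rpow_nonneg (Nat.cast_nonneg p) _) (by lia)

theorem threshold_lt_vp (hd : 2 ≤ d) (hc : c ≠ 0) (k : ℕ)
    (h : (((k : ℝ) * (padicValNat p d : ℝ)
      + (padicValNat p (d - 1).factorial : ℝ) / ((d : ℝ) - 1) : ℝ) : EReal) < vp p c) :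
    ‖c‖ ^ (d - 1) < (‖(d : ℂ_[p])‖ ^ k) ^ (d - 1) * ‖((d - 1).factorial : ℂ_[p])‖ := by
  rw [← rpow_threshold_pow hd]
  exact pow_lt_pow_left₀ ((lt_vp_iff hc _).1 h) (norm_nonneg _) (by lia)

/-- Both conditions, in multiplicative form. -/
theorem norm_bounds_of_condition (hd : 2 ≤ d) (h : ConditionA p N d c ∨ ConditionB p N d c) :
    c ≠ 0 ∧ p ∣ d ∧
      (‖(d : ℂ_[p])‖ ^ (N + 1)) ^ (d - 1) * ‖((d - 1).factorial : ℂ_[p])‖ < ‖c‖ ^ (d - 1) ∧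
      (1 ≤ N → (∃ k, d = p ^ k) ∧
        ‖c‖ ^ (d - 1) < (‖(d : ℂ_[p])‖ ^ N) ^ (d - 1) * ‖((d - 1).factorial : ℂ_[p])‖) := by
  rcases h with ⟨rfl, hpd, h⟩ | ⟨hN, ⟨k, hk⟩, h1, h2⟩
  · have hc := ne_zero_of_vp_lt h
    exact ⟨hc, hpd, vp_lt_threshold hd hc (0 + 1) (by simpa using h), fun h0 => by lia⟩
  · have hc := ne_zero_of_vp_lt h2
    refine ⟨hc, ?_, vp_lt_threshold hd hc (N + 1) (by push_cast; exact h2), fun _ =>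
      ⟨⟨k, hk⟩, threshold_lt_vp hd hc N h1⟩⟩
    rw [hk]
    refine dvd_pow_self p ?_
    rintro rfl
    lia

theorem rN_pos (hd : d ≠ 0) (hc : c ≠ 0) : 0 < rN p N d c := by
  have hp0 : (0 : ℝ) < p := zero_lt_one.trans (one_lt_natCast_prime p)
  have : 0 < ‖c / (d : ℂ_[p]) ^ (N + 1)‖ :=
    norm_pos_iff.2 (div_ne_zero hc (pow_ne_zero _ (by exact_mod_cast hd)))
  rw [rN]
  positivity

theorem rN_pow (hd : d ≠ 0) :
    rN p N d c ^ d ^ N = ‖c‖ / (‖(d : ℂ_[p])‖ ^ (N + 1) * expRadius p) := by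
  have hd' : ((d : ℝ) ^ N) ≠ 0 := pow_ne_zero _ (by exact_mod_cast hd)
  rw [rN, ← Real.rpow_natCast, ← Real.rpow_mul (by positivity), Nat.cast_pow,
    one_div_mul_cancel hd', Real.rpow_one, norm_div, norm_pow, expRadius,
    Real.rpow_neg (Nat.cast_nonneg p), ← div_div, div_inv_eq_mul]

/-- At the inverse of `rN`, the sequence `‖c‖ * R ^ (d ^ j)` compared with `q * ‖d‖ ^ (j + 1)`
peaks at `j = N`. -/
theorem critical_radius (hd : 2 ≤ d) (h : ConditionA p N d c ∨ ConditionB p N d c) {R : ℝ}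
    (hR : R = (rN p N d c)⁻¹) :
    ‖c‖ * R ^ d ^ N = expRadius p * ‖(d : ℂ_[p])‖ ^ (N + 1) ∧
      (R ^ d ^ N) ^ (d - 1) < ‖(d : ℂ_[p])‖ ∧
      ∀ i, i + 1 = N → ‖(d : ℂ_[p])‖ < (R ^ d ^ i) ^ (d - 1) := by
  obtain ⟨hc, hpd, hlow, hup⟩ := norm_bounds_of_condition hd h
  have hd0 : d ≠ 0 := by lia
  have hC : 0 < ‖c‖ := norm_pos_iff.2 hc
  have hq := expRadius_pos p
  have he := norm_natCast_pos p hd0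
  have hr := rN_pos (N := N) hd0 hc
  have hRpos : 0 < R := by rw [hR]; positivity
  set q := expRadius p with hqdef
  set e := ‖(d : ℂ_[p])‖ with hedef
  set f := ‖((d - 1).factorial : ℂ_[p])‖ with hfdef
  have hY : R ^ d ^ N = e ^ (N + 1) * q / ‖c‖ := by
    rw [hR, inv_pow, rN_pow hd0, inv_div]
  have hdf : ‖((d.factorial : ℕ) : ℂ_[p])‖ = e * f := by
    rw [← Nat.mul_factorial_pred hd0, Nat.cast_mul, norm_mul]
  have hYpow : (R ^ d ^ N) ^ (d - 1) * ‖c‖ ^ (d - 1) = (e ^ (N + 1)) ^ (d - 1) * q ^ (d - 1) := by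
    rw [← mul_pow, ← mul_pow, hY, div_mul_cancel₀ _ hC.ne']
  have hqd : q * q ^ (d - 1) = q ^ d := by rw [← pow_succ', Nat.sub_add_cancel (by lia)]
  have hCd : 0 < ‖c‖ ^ (d - 1) := by positivity
  refine ⟨?_, ?_, ?_⟩
  · rw [hY, mul_div_cancel₀ _ hC.ne', mul_comm]
  -- For every `d`, the quantity `q ^ d` is at most `q * ‖d!‖ = q * ‖d‖ * ‖(d - 1)!‖`.
  · have hqf : q ^ (d - 1) ≤ e * f := by
      have := expRadius_pow_le p hd0
      rw [hdf, ← hqdef, ← hqd] at this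
      exact le_of_mul_le_mul_left this hq
    refine lt_of_mul_lt_mul_right ?_ hCd.le
    rw [hYpow]
    calc (e ^ (N + 1)) ^ (d - 1) * q ^ (d - 1) ≤ (e ^ (N + 1)) ^ (d - 1) * (e * f) := by gcongr
      _ = e * ((e ^ (N + 1)) ^ (d - 1) * f) := by ring
      _ < e * ‖c‖ ^ (d - 1) := by gcongr
  · rintro i rfl
    obtain ⟨⟨k, hk⟩, hup⟩ := hup (by lia)
    -- The bound `q ^ d ≤ q * ‖d!‖` is an equality for a power of `p`.
    have hqf : q ^ (d - 1) = e * f := by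
      have := expRadius_pow_prime_pow p k
      rw [← hk, hdf, ← hqdef, ← hqd] at this
      exact mul_left_cancel₀ hq.ne' this
    have hlt : e ^ d < ((R ^ d ^ i) ^ (d - 1)) ^ d := by
      have h1 : ((R ^ d ^ i) ^ (d - 1)) ^ d = (R ^ d ^ (i + 1)) ^ (d - 1) := by
        rw [pow_succ d i]; ring
      rw [h1]
      refine lt_of_mul_lt_mul_right ?_ hCd.le
      rw [hYpow, hqf]
      have h2 : e ^ d = e ^ (d - 1) * e := by rw [← pow_succ, Nat.sub_add_cancel (by lia)]
      calc e ^ d * ‖c‖ ^ (d - 1) < e ^ d * ((e ^ (i + 1)) ^ (d - 1) * f) := by gcongr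
        _ = (e ^ (i + 1) * e) ^ (d - 1) * (e * f) := by rw [h2, mul_pow (e ^ (i + 1)) e]; ring
        _ = _ := by rw [← pow_succ]
    exact lt_of_pow_lt_pow_left₀ d (by positivity) hlt

theorem exists_norm_eq_expRadius (p : ℕ) [Fact p.Prime] : ∃ π : ℂ_[p], ‖π‖ = expRadius p := by
  have hp : p.Prime := Fact.out
  have h1 := one_lt_natCast_prime p
  have hp1 : p - 1 ≠ 0 := by have := hp.two_le; lia
  obtain ⟨π, hπ⟩ := IsAlgClosed.exists_pow_nat_eq (p : ℂ_[p]) (Nat.pos_of_ne_zero hp1)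
  refine ⟨π, ?_⟩
  refine (pow_left_inj₀ (norm_nonneg _) (expRadius_pos p).le hp1).1 ?_
  have h2 : ((p - 1 : ℕ) : ℝ) = p - 1 := by rw [Nat.cast_sub hp.one_le, Nat.cast_one]
  rw [← norm_pow, hπ, expRadius_pow, norm_natCast_eq p hp.ne_zero, h2,
    div_self (by linarith : (p : ℝ) - 1 ≠ 0), padicValNat_self, Nat.cast_one]

theorem exists_norm_eq_rN_rpow (hd : d ≠ 0) (hc : c ≠ 0) :
    ∃ x : ℂ_[p], ‖x‖ = rN p N d c ^ (1 / (d : ℝ)) := by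
  obtain ⟨π, hπ⟩ := exists_norm_eq_expRadius p
  have hD : d * d ^ N ≠ 0 := mul_ne_zero hd (pow_ne_zero _ hd)
  obtain ⟨x, hx⟩ := IsAlgClosed.exists_pow_nat_eq (c / ((d : ℂ_[p]) ^ (N + 1) * π))
    (Nat.pos_of_ne_zero hD)
  have hr := rN_pos (N := N) hd hc
  refine ⟨x, (pow_left_inj₀ (norm_nonneg _) (by positivity) hD).1 ?_⟩
  rw [← norm_pow, hx, pow_mul, one_div, Real.rpow_inv_natCast_pow hr.le hd, rN_pow hd, norm_div,
    norm_mul, norm_pow, hπ]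

end Conditions

end BottcherAtInfinity

theorem theorem1p2 (p : ℕ) [Fact p.Prime] (N d : ℕ) (hd : 2 ≤ d) (c : ℂ_[p])
    (h : ConditionA p N d c ∨ ConditionB p N d c) :
    -- the series `φ_c` exists and is unique
    (∃! φ : PowerSeries ℂ_[p], IsInverseBottcher d c φ) ∧
    ∀ φ : PowerSeries ℂ_[p], IsInverseBottcher d c φ →
      -- its formal inverse exists and is unique
      (∃! ψ : PowerSeries ℂ_[p], IsFormalInverse φ ψ) ∧
      (∀ ψ : PowerSeries ℂ_[p], IsFormalInverse φ ψ →
        IsMaximalConvergentDisk ψ (diskAtInfinity p (rN p N d c ^ (1 / (d : ℝ))))) ∧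
      IsMaximalConvergentDisk φ (diskAtInfinity p (rN p N d c ^ (1 / (d : ℝ)))) ∧
      1 < rN p N d c ∧
      Set.BijOn (value φ) (diskAtInfinity p (rN p N d c ^ (1 / (d : ℝ))))
        (diskAtInfinity p (rN p N d c ^ (1 / (d : ℝ)))) ∧
      (∀ x ∈ diskAtInfinity p (rN p N d c ^ (1 / (d : ℝ))),
        ∀ y ∈ diskAtInfinity p (rN p N d c ^ (1 / (d : ℝ))),
          ‖value φ x - value φ y‖ = ‖x - y‖) := by
  have hd0 : d ≠ 0 := by lia
  obtain ⟨hc, hpd, -, -⟩ := norm_bounds_of_condition hd h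
  have hdK : (d : ℂ_[p]) ≠ 0 := by exact_mod_cast hd0
  refine ⟨existsUnique_isInverseBottcher hd hdK c, fun φ hφ => ?_⟩
  obtain ⟨v, rfl, hv0, hv⟩ := (isInverseBottcher_iff hd0 c).1 hφ
  set E := PowerSeries.expand d hd0 (1 + v) with hE
  have hr := rN_pos (N := N) hd0 hc
  set r := rN p N d c with hrdef
  obtain ⟨hN, h1, h2⟩ := critical_radius hd h (R := r⁻¹) rfl
  have hq := expRadius_pos p
  have hq1 := expRadius_lt_one p
  have he1 := norm_natCast_lt_one p hd0 hpd
  have hR : 0 < r⁻¹ := inv_pos.2 hr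
  have hr1 : 1 < r := by
    by_contra! hle
    have : 1 ≤ (r⁻¹ ^ d ^ N) ^ (d - 1) := one_le_pow₀ (one_le_pow₀ ((one_le_inv₀ hr).2 hle))
    linarith
  obtain ⟨δ, hδ1, hdδ, hj⟩ := exists_peak hd (norm_pos_iff.2 hc) hR hq
    (norm_natCast_pos p hd0) he1 hN h1 h2
  obtain ⟨hvq, hveq⟩ := norm_coeff_of_functional_eq hd hpd hR hv0 hv hδ1 hdδ hN hj
  set s := (r ^ (1 / (d : ℝ)))⁻¹ with hsdef
  have hs : 0 < s := inv_pos.2 (Real.rpow_pos_of_pos hr _)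
  have hsd : s ^ d = r⁻¹ := by
    rw [hsdef, inv_pow, one_div, Real.rpow_inv_natCast_pow hr.le hd0]
  have hrs : r ^ (1 / (d : ℝ)) = s⁻¹ := (inv_inv _).symm
  rw [hrs]
  have hE0 : PowerSeries.constantCoeff E = 1 := by simp [hE, hv0]
  have hEq : GaussLe s (expRadius p) (E - 1) := by
    rw [hE, map_add, map_one, add_sub_cancel_left]
    exact GaussLe.expand hd0 (by rwa [hsd])
  have hEeq (k : ℕ) : ‖PowerSeries.coeff (d * (d ^ N * p ^ k)) E‖ * s ^ (d * (d ^ N * p ^ k))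
      = expRadius p := by
    have hne : d ^ N * p ^ k ≠ 0 :=
      mul_ne_zero (pow_ne_zero _ hd0) (pow_ne_zero _ (Fact.out : p.Prime).ne_zero)
    rw [hE, PowerSeries.coeff_expand_mul, map_add, PowerSeries.coeff_one, if_neg hne, zero_add,
      pow_mul, hsd, hveq k]
  have hle (k : ℕ) : k ≤ d * (d ^ N * p ^ k) := by
    have h3 : k < p ^ k := Nat.lt_pow_self (Fact.out : p.Prime).one_lt
    have h4 : 0 < d * d ^ N := by positivity
    calc k ≤ 1 * p ^ k := by lia
      _ ≤ d * d ^ N * p ^ k := Nat.mul_le_mul_right _ h4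
      _ = _ := by ring
  have hne (k : ℕ) : d * (d ^ N * p ^ k) ≠ 0 :=
    mul_ne_zero hd0 (mul_ne_zero (pow_ne_zero _ hd0)
      (pow_ne_zero _ (Fact.out : p.Prime).ne_zero))
  obtain ⟨x₀, hx₀⟩ := exists_norm_eq_rN_rpow (N := N) hd0 hc
  rw [← hrdef, hrs] at hx₀
  -- The coefficients of index `d * (d ^ N * p ^ k)`, of size `q * s ^ (-index)`, prevent
  -- convergence on the circle through `x₀`.
  refine ⟨?_, fun ψ hψ => ?_, ?_, hr1, bijOn_value hs hq1 hEq, fun x hx y hy =>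
    norm_value_sub_value hs hq1 hEq hx hy⟩
  · simpa only [isFormalInverse_iff hE0] using existsUnique_mul_subst_eq_one hE0
  · rw [isFormalInverse_iff hE0] at hψ
    refine isMaximalConvergentDisk hs hq (M := 1) ?_ ?_ hx₀
    · have := ((GaussLe.inverse hs.le hq1.le hE0 hEq hψ).1.mono hq1.le).add hs.le GaussLe.one
      rwa [sub_add_cancel] at this
    · exact Filter.frequently_atTop.2 fun k =>
        ⟨_, hle k, norm_coeff_inverse_eq hs hq hq1 hE0 hEq hψ (hne k) (hEeq k)⟩
  · refine isMaximalConvergentDisk hs hq (M := 1) ?_ ?_ hx₀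
    · have := (hEq.mono hq1.le).add hs.le GaussLe.one
      rwa [sub_add_cancel] at this
    · exact Filter.frequently_atTop.2 fun k => ⟨_, hle k, hEeq k⟩
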